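/- Let $\Omega\subset\mathbb R^2$ be a convex polygonal domain and let $\mathscr T_h$ be a (finite, conforming) triangulation of $\overline\Omega$ with set of edges $\mathcal E_h$; let $\Gamma_\partial\subset\mathcal E_h$ be the edges on $\partial\Omega$. Let $k\ge 0$ and $$W_h=\{w\in L^2(\Omega): w|_K\in\mathcal P_k(K)\ \forall K\in\mathscr T_h\},\quad V_h=\{v\in L^2(\Omega)^2: v|_K\in\mathcal P_k(K)^2\ \forall K\in\mathscr T_h\},$$ $$M_h=\{\mu\in L^2(\mathcal E_h):\mu|_E\in\mathcal P_k(E)\ \forall E\in\mathcal E_h\},$$ where $\mathcal P_k$ denotes polynomials of degree $\le k$. Let $\tau:\mathcal E_h\to(0,\infty)$ be constant on each edge, let $u_1\in L^2(\Omega)$, and let $0<\Delta t\le 1$ (in particular $\Delta t=1/N$ with $N\in\mathbb N$, $N\ge1$). Write $(\cdot,\cdot)=\sum_K\int_K$ and $\langle\cdot,\cdot\rangle=\sum_K\int_{\partial K}$, with derivatives taken elementwise and $n$ the outward unit normal of $K$ on $\partial K$. Put $\langle\cdot,\cdot\rangle_{\mathcal E_h\setminus\Gamma_\partial}=\sum_{E\in\mathcal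 E_h\setminus\Gamma_\partial}\int_E$, where the normal component of the numerical flux enters as the sum of the contributions of the two elements sharing $E$, and $\langle\cdot,\cdot\rangle_{\Gamma_\partial}=\sum_{E\in\Gamma_\partial}\int_E$. Let $F(s)=\frac14(1-s^2)^2$ and $$\mathscr F(a,b)=\begin{cases}\dfrac{F(a)-F(b)}{a-b},&a\ne b,\\[1ex] F'(a),&a=b.\end{cases}$$ For a triple $(U^m,Q^m,\widehat U^m)\in W_h\times V_h\times M_h$ the numerical flux is, on the boundary of each element, $$\widehat Q^m\cdot n=Q^m\cdot n-\tau\,(U^m-\widehat U^m).$$ **Theorem (existence and uniqueness).** Let $n\ge 0$ and let arbitrary triples $(U^m,Q^m,\widehat U^m)\in W_h\times V_h\times M_h$, $m=0,1,\dots,n$, be given. Then there is exactly one triple $(U^{n+1},Q^{n+1},\widehat U^{n+1})\in W_h\times V_h\times M_h$ such that for all $w\in W_h$, $v\in V_h$, $\mu_1,\mu_2\in M_h$: * if $n\ge1$, $$\Big(\tfrac{U^{n+1}-2U^n+U^{n-1}}{\Delta t^2},w\Big)+\Big(\tfrac{Q^{n+1}+Q^{n-1}}2,\nabla w\Big)-\Big\langle\tfrac{\widehat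 Q^{n+1}\cdot n+\widehat Q^{n-1}\cdot n}2,w\Big\rangle+\big(\mathscr F(U^{n+1},U^{n-1}),w\big)=0;$$ * if $n=0$, $$\tfrac2{\Delta t}\Big(\tfrac{U^1-U^0}{\Delta t},w\Big)+\Big(\tfrac{Q^1+Q^0}2,\nabla w\Big)-\Big\langle\tfrac{\widehat Q^1\cdot n+\widehat Q^0\cdot n}2,w\Big\rangle+\big(\mathscr F(U^1,U^0),w\big)-\tfrac2{\Delta t}(u_1,w)=0;$$ * and, in both cases, $$(Q^{n+1},v)+(U^{n+1},\nabla\cdot v)-\langle\widehat U^{n+1},v\cdot n\rangle=0,\qquad \langle\widehat Q^{n+1}\cdot n,\mu_1\rangle_{\mathcal E_h\setminus\Gamma_\partial}=0,\qquad \langle\widehat U^{n+1},\mu_2\rangle_{\Gamma_\partial}=0.$$ -/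

import Mathlib

open MeasureTheory
open scoped RealInnerProductSpace

noncomputable section

namespace HDG

/-- The Euclidean plane `ℝ²`. -/
abbrev Plane : Type := EuclideanSpace ℝ (Fin 2)

/-- A convex polygonal domain in the plane: a nonempty open convex set whose closure is a
convex polygon (the convex hull of finitely many points). -/
def IsConvexPolygonalDomain (Ω : Set Plane) : Prop :=
  IsOpen Ω ∧ Convex ℝ Ω ∧ Ω.Nonempty ∧
    ∃ P : Finset Plane, closure Ω = convexHull ℝ (P : Set Plane)

/-- A (finite, conforming) triangulation of `closure Ω`. An element is given by its three
vertices and stands for the closed nondegenerate triangle they span. The elements cover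
`closure Ω`, and any two of them meet in the simplex spanned by their common vertices (nothing,
a common vertex, a common edge, or the whole triangle when the two are equal). -/
structure Triangulation (Ω : Set Plane) where
  elements : Finset (Finset Plane)
  card_eq : ∀ T ∈ elements, T.card = 3
  nondegenerate : ∀ T ∈ elements, AffineIndependent ℝ ((↑) : T → Plane)
  cover : (⋃ T ∈ elements, convexHull ℝ (T : Set Plane)) = closure Ω
  conforming : ∀ T ∈ elements, ∀ T' ∈ elements,
    convexHull ℝ (T : Set Plane) ∩ convexHull ℝ (T' : Set Plane) =
      convexHull ℝ ((T : Set Plane) ∩ (T' : Set Plane))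

/-- `n` is the unit normal of the side `e` of the triangle with vertex set `T` that points out of
the triangle: it is orthogonal to `e`, and the opposite vertex lies on its negative side. -/
def IsOutwardNormal (T e : Finset Plane) (n : Plane) : Prop :=
  ‖n‖ = 1 ∧ (∀ x ∈ e, ∀ y ∈ e, ⟪n, y - x⟫ = 0) ∧
    ∀ x ∈ e, ∀ c ∈ T, c ∉ e → ⟪n, c - x⟫ < 0

/-- The outward unit normal exists and is unique on each side of a nondegenerate triangle. -/
theorem existsUnique_isOutwardNormal {T e : Finset Plane} (hT : T.card = 3)
    (hind : AffineIndependent ℝ ((↑) : T → Plane)) (heT : e ⊆ T) (he : e.card = 2) :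
    ∃! n : Plane, IsOutwardNormal T e n := by
  classical
  obtain ⟨a, b, hab, rfl⟩ := Finset.card_eq_two.mp he
  obtain ⟨c, hcT, hce⟩ : ∃ c ∈ T, c ∉ ({a, b} : Finset Plane) := by
    by_contra! h
    have := Finset.card_le_card (show T ⊆ {a, b} from h)
    omega
  have hTe : T = insert c {a, b} := by
    refine (Finset.eq_of_subset_of_card_le (Finset.insert_subset hcT heT) ?_).symm
    rw [Finset.card_insert_of_notMem hce]
    omega
  have haT : a ∈ T := heT (by simp)
  have hbT : b ∈ T := heT (by simp)
  have hca : c ≠ a := fun h => hce (by simp [h])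
  have hcb : c ≠ b := fun h => hce (by simp [h])
  have hin : ∀ u v : Plane, ⟪u, v⟫ = u 0 * v 0 + u 1 * v 1 := by
    intro u v
    rw [EuclideanSpace.inner_eq_star_dotProduct]
    simp [dotProduct, Fin.sum_univ_two]
    ring
  have hnorm : ∀ u : Plane, ‖u‖ = 1 ↔ u 0 ^ 2 + u 1 ^ 2 = 1 := by
    intro u
    rw [EuclideanSpace.norm_eq, Real.sqrt_eq_one]
    simp [Fin.sum_univ_two]
  set p := b 0 - a 0 with hp
  set q := b 1 - a 1 with hq
  set r := c 0 - a 0 with hr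
  set s := c 1 - a 1 with hs
  have hpq : 0 < p ^ 2 + q ^ 2 := by
    by_contra! h
    have h1 : p = 0 := by nlinarith [sq_nonneg p, sq_nonneg q]
    have h2 : q = 0 := by nlinarith [sq_nonneg p, sq_nonneg q]
    apply hab
    ext i
    fin_cases i <;> simp <;> linarith
  have hdet : q * r - p * s ≠ 0 := by
    intro h0
    have hemb : Function.Injective
        (![⟨a, haT⟩, ⟨b, hbT⟩, ⟨c, hcT⟩] : Fin 3 → T) := by
      intro i j hij
      fin_cases i <;> fin_cases j <;> simp_all
    have h3 := hind.comp_embedding ⟨_, hemb⟩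
    rw [affineIndependent_iff_not_collinear] at h3
    apply h3
    have ha3 : a ∈ Set.range (((↑) : T → Plane) ∘
        (![⟨a, haT⟩, ⟨b, hbT⟩, ⟨c, hcT⟩] : Fin 3 → T)) := ⟨0, rfl⟩
    refine (collinear_iff_of_mem ha3).mpr ?_
    refine ⟨b - a, ?_⟩
    rintro _ ⟨i, rfl⟩
    fin_cases i
    · exact ⟨0, by simp⟩
    · exact ⟨1, by simp⟩
    · refine ⟨(r * p + s * q) / (p ^ 2 + q ^ 2), ?_⟩
      ext j
      fin_cases j
      · have : r = (r * p + s * q) / (p ^ 2 + q ^ 2) * p := by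
          field_simp
          linear_combination q * h0
        simp [← hp]
        linarith
      · have : s = (r * p + s * q) / (p ^ 2 + q ^ 2) * q := by
          field_simp
          linear_combination (-p) * h0
        simp [← hq]
        linarith
  -- the conditions, in coordinates
  have key : ∀ n : Plane, IsOutwardNormal T {a, b} n ↔
      n 0 ^ 2 + n 1 ^ 2 = 1 ∧ n 0 * p + n 1 * q = 0 ∧ n 0 * r + n 1 * s < 0 := by
    intro n
    unfold IsOutwardNormal
    rw [hnorm, hTe]
    simp only [hin, Finset.mem_insert, Finset.mem_singleton, PiLp.sub_apply]
    constructor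
    · rintro ⟨h1, h2, h3⟩
      refine ⟨h1, h2 a (Or.inl rfl) b (Or.inr rfl), h3 a (Or.inl rfl) c (Or.inl rfl) ?_⟩
      simp [hca, hcb]
    · rintro ⟨h1, h2, h3⟩
      refine ⟨h1, ?_, ?_⟩
      · rintro x (rfl | rfl) y (rfl | rfl) <;> linarith
      · rintro x hx d (rfl | hd) hd'
        · rcases hx with rfl | rfl
          · exact h3
          · rw [hp, hq] at h2
            rw [hr, hs] at h3
            linarith
        · exact absurd hd hd'
  simp only [key]
  set δ := q * r - p * s with hδ
  set L := Real.sqrt (p ^ 2 + q ^ 2) with hL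
  have hLp : 0 < L := Real.sqrt_pos.mpr hpq
  have hL2 : L ^ 2 = p ^ 2 + q ^ 2 := Real.sq_sqrt hpq.le
  have hδp : 0 < |δ| := abs_pos.mpr hdet
  have hδ2 : |δ| ^ 2 = δ ^ 2 := sq_abs δ
  refine ⟨!₂[-(δ / |δ| / L) * q, (δ / |δ| / L) * p], ⟨?_, ?_, ?_⟩, ?_⟩
  · simp
    field_simp
    rw [hL2, hδ2]
    ring
  · simp
    ring
  · have : -(δ / |δ| / L) * q * r + δ / |δ| / L * p * s = - (|δ| / L) := by
      field_simp
      rw [hδ2, hδ]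
      ring
    simp only [Matrix.cons_val_zero, Matrix.cons_val_one]
    rw [this]
    have : 0 < |δ| / L := by positivity
    linarith
  · rintro m ⟨h1, h2, h3⟩
    -- `m` is a multiple `t` of `(-q, p)`
    set t := (m 1 * p - m 0 * q) / (p ^ 2 + q ^ 2) with ht
    have hm0 : m 0 = -t * q := by
      rw [ht]
      field_simp
      linear_combination p * h2
    have hm1 : m 1 = t * p := by
      rw [ht]
      field_simp
      linear_combination q * h2
    have htL : (t * L) ^ 2 = 1 := by
      rw [mul_pow, hL2, ← h1, hm0, hm1]
      ring
    have htδ : 0 < t * δ := by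
      rw [hm0, hm1] at h3
      rw [hδ]
      linarith
    have htv : t = δ / |δ| / L := by
      rcases lt_or_gt_of_ne hdet with hneg | hpos
      · have ht0 : t < 0 := by
          by_contra! h
          exact absurd (mul_nonpos_of_nonneg_of_nonpos h hneg.le) (not_le.mpr htδ)
        have : t * L = -1 := by
          have h5 : t * L < 0 := mul_neg_of_neg_of_pos ht0 hLp
          rcases (mul_self_eq_one_iff.mp ((sq _).symm.trans htL)) with h | h <;> linarith
        rw [abs_of_neg hneg]
        field_simp
        linarith
      · have ht0 : 0 < t := by
          by_contra! h
          exact absurd (mul_nonpos_of_nonpos_of_nonneg h hpos.le) (not_le.mpr htδ)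
        have : t * L = 1 := by
          have h5 : 0 < t * L := mul_pos ht0 hLp
          rcases (mul_self_eq_one_iff.mp ((sq _).symm.trans htL)) with h | h <;> linarith
        rw [abs_of_pos hpos]
        field_simp
        linarith
    ext i
    fin_cases i
    · simp [hm0, htv]
    · simp [hm1, htv]

/-- The outward unit normal vector of the triangle `T` on its side `e`. -/
def outwardNormal (T e : Finset Plane) : Plane :=
  Classical.epsilon (IsOutwardNormal T e)

theorem isOutwardNormal_outwardNormal {T e : Finset Plane} (hT : T.card = 3)
    (hind : AffineIndependent ℝ ((↑) : T → Plane)) (heT : e ⊆ T) (he : e.card = 2) :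
    IsOutwardNormal T e (outwardNormal T e) :=
  Classical.epsilon_spec (existsUnique_isOutwardNormal hT hind heT he).exists

/-- The polynomials in two variables of total degree at most `k`. -/
abbrev Poly (k : ℕ) : Type := MvPolynomial.restrictTotalDegree (Fin 2) ℝ k

/-- The value of a polynomial at a point of the plane. -/
def pval (p : MvPolynomial (Fin 2) ℝ) (x : Plane) : ℝ :=
  MvPolynomial.eval (fun i => x i) p

/-- The closed straight segment (edge) spanned by a set of two vertices. -/
abbrev Seg (e : Finset Plane) : Type := ↥(convexHull ℝ (e : Set Plane))

/-- Restriction of polynomials in two variables to an edge, as a linear map into the functions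
on that edge. -/
def restrictToEdge (e : Finset Plane) : MvPolynomial (Fin 2) ℝ →ₗ[ℝ] (Seg e → ℝ) where
  toFun p := fun x => pval p (x : Plane)
  map_add' p q := by
    funext x
    simp [pval]
  map_smul' c p := by
    funext x
    simp [pval]

/-- `P_k(E)`: the functions on the edge `E` which are polynomials of degree at most `k`. -/
def edgePoly (k : ℕ) (e : Finset Plane) : Submodule ℝ (Seg e → ℝ) :=
  (MvPolynomial.restrictTotalDegree (Fin 2) ℝ k).map (restrictToEdge e)

/-- `F(s) = (1 - s²)² / 4`. -/
def F (s : ℝ) : ℝ := (1 / 4) * (1 - s ^ 2) ^ 2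

open scoped Classical in
/-- The difference quotient of `F`, with the value `F'` on the diagonal. -/
def scrF (a b : ℝ) : ℝ := if a ≠ b then (F a - F b) / (a - b) else deriv F a

namespace Triangulation

variable {Ω : Set Plane} (𝒯 : Triangulation Ω)

open scoped Classical in
/-- The set of all edges: the two-vertex subsets of the elements. -/
def edges : Finset (Finset Plane) := 𝒯.elements.biUnion fun T => T.powersetCard 2

/-- The type of elements of the triangulation. -/
abbrev Elem : Type := {T : Finset Plane // T ∈ 𝒯.elements}

/-- The type of edges of the triangulation. -/
abbrev Edge : Type := {e : Finset Plane // e ∈ 𝒯.edges}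

/-- The edge lies on the boundary of the domain. -/
def IsBoundaryEdge (e : 𝒯.Edge) : Prop := convexHull ℝ (e.1 : Set Plane) ⊆ frontier Ω

/-- `W_h`: on each element a polynomial of degree at most `k`, without continuity between
elements. (A polynomial is determined by its restriction to a nondegenerate triangle, so
`P_k(K)` is represented by the polynomials themselves.) -/
abbrev W (k : ℕ) : Type := 𝒯.Elem → Poly k

/-- `V_h`: on each element a vector field with polynomial components of degree at most `k`. -/
abbrev V (k : ℕ) : Type := 𝒯.Elem → Fin 2 → Poly k

/-- `M_h`: on each edge a polynomial function of degree at most `k`, single valued on the edge and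
without continuity between edges. -/
abbrev M (k : ℕ) : Type := (e : 𝒯.Edge) → edgePoly k e.1

/-- `∑_K ∫_K g`. -/
def elemInt (g : 𝒯.Elem → Plane → ℝ) : ℝ :=
  ∑ T : 𝒯.Elem, ∫ x in convexHull ℝ (T.1 : Set Plane), g T x

open scoped Classical in
/-- `∑_K ∫_{∂K} g`, where `g` may take different values on an edge as seen from its two
neighbouring elements; the measure on an edge is arc length. -/
def skelInt (g : 𝒯.Elem → (e : 𝒯.Edge) → Seg e.1 → ℝ) : ℝ :=
  ∑ T : 𝒯.Elem, ∑ e : 𝒯.Edge with e.1 ⊆ T.1, ∫ x : Seg e.1, g T e x ∂(μH[1])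

open scoped Classical in
/-- The sum, over all edges not on the boundary of the domain, of the integrals over the edge of
the contributions of all elements having this edge. -/
def interiorInt (g : 𝒯.Elem → (e : 𝒯.Edge) → Seg e.1 → ℝ) : ℝ :=
  ∑ e : 𝒯.Edge with ¬ 𝒯.IsBoundaryEdge e,
    ∑ T : 𝒯.Elem with e.1 ⊆ T.1, ∫ x : Seg e.1, g T e x ∂(μH[1])

open scoped Classical in
/-- The sum, over all edges on the boundary of the domain, of the integrals over the edge. -/
def boundaryInt (g : (e : 𝒯.Edge) → Seg e.1 → ℝ) : ℝ :=
  ∑ e : 𝒯.Edge with 𝒯.IsBoundaryEdge e, ∫ x : Seg e.1, g e x ∂(μH[1])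

variable {𝒯} {k : ℕ}

/-- The value of `w|_K` at a point. -/
def uval (w : 𝒯.W k) (T : 𝒯.Elem) (x : Plane) : ℝ := pval (w T).1 x

/-- The `i`-th component of `∇ (w|_K)`. -/
def grad (w : 𝒯.W k) (T : 𝒯.Elem) (i : Fin 2) (x : Plane) : ℝ :=
  pval (MvPolynomial.pderiv i (w T).1) x

/-- The `i`-th component of `v|_K`. -/
def vval (v : 𝒯.V k) (T : 𝒯.Elem) (i : Fin 2) (x : Plane) : ℝ := pval (v T i).1 x

/-- `∇ · (v|_K)`. -/
def divergence (v : 𝒯.V k) (T : 𝒯.Elem) (x : Plane) : ℝ :=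
  ∑ i, pval (MvPolynomial.pderiv i (v T i).1) x

/-- `v|_K · n` on the edge `e` of `K`, with `n` the outward unit normal of `K`. -/
def normalTrace (v : 𝒯.V k) (T : 𝒯.Elem) (e : 𝒯.Edge) (x : Seg e.1) : ℝ :=
  ∑ i, vval v T i x * outwardNormal T.1 e.1 i

/-- The value of `μ ∈ M_h` at a point of the edge `e`. -/
def mval (μ : 𝒯.M k) (e : 𝒯.Edge) (x : Seg e.1) : ℝ := (μ e).1 x

/-- The numerical flux `Q̂ · n = Q · n - τ (U - Û)` on the edge `e` of the element `T`. -/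
def flux (τ : 𝒯.Edge → ℝ) (X : 𝒯.W k × 𝒯.V k × 𝒯.M k) (T : 𝒯.Elem) (e : 𝒯.Edge)
    (x : Seg e.1) : ℝ :=
  normalTrace X.2.1 T e x - τ e * (uval X.1 T x - mval X.2.2 e x)

/-- `(Q, v) + (U, ∇ · v) - ⟨Û, v · n⟩ = 0` for all `v ∈ V_h`. -/
def GradientEq (X : 𝒯.W k × 𝒯.V k × 𝒯.M k) : Prop :=
  ∀ v : 𝒯.V k,
    𝒯.elemInt (fun T x => ∑ i, vval X.2.1 T i x * vval v T i x)
      + 𝒯.elemInt (fun T x => uval X.1 T x * divergence v T x)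
      - 𝒯.skelInt (fun T e x => mval X.2.2 e x * normalTrace v T e x) = 0

/-- `⟨Q̂ · n, μ⟩ = 0` over the edges not on the boundary, for all `μ ∈ M_h`. -/
def FluxEq (τ : 𝒯.Edge → ℝ) (X : 𝒯.W k × 𝒯.V k × 𝒯.M k) : Prop :=
  ∀ μ : 𝒯.M k, 𝒯.interiorInt (fun T e x => flux τ X T e x * mval μ e x) = 0

/-- `⟨Û, μ⟩ = 0` over the boundary edges, for all `μ ∈ M_h`. -/
def BoundaryEq (X : 𝒯.W k × 𝒯.V k × 𝒯.M k) : Prop :=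
  ∀ μ : 𝒯.M k, 𝒯.boundaryInt (fun e x => mval X.2.2 e x * mval μ e x) = 0

/-- The equation of motion of the first time step, for the unknown `Y` at time level `1` and the
given `X` at time level `0`: for all `w ∈ W_h`,
`(2/Δt) ((U¹ - U⁰)/Δt, w) + (Q^{1/2}, ∇ w) - ⟨Q̂^{1/2} · n, w⟩ + (ℱ(U¹, U⁰), w)
  - (2/Δt) (u₁, w) = 0`. -/
def FirstStepEq (τ : 𝒯.Edge → ℝ) (Δt : ℝ) (u₁ : Plane → ℝ)
    (X Y : 𝒯.W k × 𝒯.V k × 𝒯.M k) : Prop :=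
  ∀ w : 𝒯.W k,
    (2 / Δt) * 𝒯.elemInt (fun T x => (uval Y.1 T x - uval X.1 T x) / Δt * uval w T x)
      + 𝒯.elemInt (fun T x =>
          ∑ i, (1 / 2) * (vval Y.2.1 T i x + vval X.2.1 T i x) * grad w T i x)
      - 𝒯.skelInt (fun T e x =>
          (1 / 2) * (flux τ Y T e x + flux τ X T e x) * uval w T x)
      + 𝒯.elemInt (fun T x => scrF (uval Y.1 T x) (uval X.1 T x) * uval w T x)
      - (2 / Δt) * 𝒯.elemInt (fun T x => u₁ x * uval w T x) = 0

/-- The equation of motion of a later time step, for the unknown `Y` at time level `n + 1` and the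
given `X` at level `n` and `Z` at level `n - 1`: for all `w ∈ W_h`,
`((U^{n+1} - 2 U^n + U^{n-1})/Δt², w) + (𝒜Q^n, ∇ w) - ⟨𝒜Q̂^n · n, w⟩
  + (ℱ(U^{n+1}, U^{n-1}), w) = 0`. -/
def LaterStepEq (τ : 𝒯.Edge → ℝ) (Δt : ℝ)
    (Z X Y : 𝒯.W k × 𝒯.V k × 𝒯.M k) : Prop :=
  ∀ w : 𝒯.W k,
    𝒯.elemInt (fun T x =>
        (1 / Δt ^ 2) * (uval Y.1 T x - 2 * uval X.1 T x + uval Z.1 T x) * uval w T x)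
      + 𝒯.elemInt (fun T x =>
          ∑ i, (1 / 2) * (vval Y.2.1 T i x + vval Z.2.1 T i x) * grad w T i x)
      - 𝒯.skelInt (fun T e x =>
          (1 / 2) * (flux τ Y T e x + flux τ Z T e x) * uval w T x)
      + 𝒯.elemInt (fun T x => scrF (uval Y.1 T x) (uval Z.1 T x) * uval w T x) = 0

/-- The equation of motion that determines time level `n + 1` from the levels `0, …, n`. -/
def MotionEq (τ : 𝒯.Edge → ℝ) (Δt : ℝ) (u₁ : Plane → ℝ) :
    (n : ℕ) → (Fin (n + 1) → 𝒯.W k × 𝒯.V k × 𝒯.M k) → 𝒯.W k × 𝒯.V k × 𝒯.M k → Prop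
  | 0, X, Y => FirstStepEq τ Δt u₁ (X 0) Y
  | n + 1, X, Y => LaterStepEq τ Δt (X (Fin.last n).castSucc) (X (Fin.last (n + 1))) Y

/-- `Y` solves the fully discrete conservative scheme at time level `n + 1`, the iterates
`X 0, …, X n` being given. -/
def IsNextIterate (τ : 𝒯.Edge → ℝ) (Δt : ℝ) (u₁ : Plane → ℝ) (n : ℕ)
    (X : Fin (n + 1) → 𝒯.W k × 𝒯.V k × 𝒯.M k) (Y : 𝒯.W k × 𝒯.V k × 𝒯.M k) : Prop :=
  MotionEq τ Δt u₁ n X Y ∧ GradientEq Y ∧ FluxEq τ Y ∧ BoundaryEq Y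

end Triangulation

end HDG

end

/-!
One time step is the Euler–Lagrange equation of a strictly convex, coercive functional on a finite
dimensional space.

Write `(U, Q, Û)` for the unknown triple and `S` for the space of triples that satisfy the discrete
gradient equation and vanish on the boundary edges (`trialSpace`). Integration by parts on each
element (`integral_triangle_pderiv`, the divergence theorem for polynomials on a triangle) and the
gradient equation for the test triple `(w, v, μ) ∈ S`, tested with `Q`, give the energy identity
`gradForm_sub_fluxW_add_fluxM`
`(Q, ∇ w) - ⟨Q̂ · n, w⟩ + ⟨Q̂ · n, μ⟩ = (Q, v) + ⟨τ (U - Û), w - μ⟩`,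
whose right-hand side is symmetric and nonnegative. For any `w` and `μ` the gradient equation can be
solved for `v`, by Riesz representation in `V_h`. Hence the equation of motion and the flux condition
together are one variational equation on `S` (`forall_motion_and_fluxEq_iff`).

The nonlinearity is the polynomial
`ℱ(a, b) = (a³ + a² b + a b²) / 4 - a / 2 + (b³ / 4 - b / 2)`.
Its first part is monotone in `a` and is the derivative of the nonnegative function
`a⁴ / 16 + a³ b / 12 + a² b² / 8`. Its second part is absorbed by the mass term, whose coefficient,
`2 / Δt²` or `1 / Δt²`, exceeds `1 / 2` since `Δt ≤ 1`. Its last part does not depend on the unknown.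
What remains is a symmetric form (`energyForm`), positive definite because `τ > 0` and every edge is
a side of an element, plus the derivative of a nonnegative potential, equal to a linear functional.
A solution is obtained by minimisation, and uniqueness follows from monotonicity
(`existsUnique_variational`).

All integrals over elements and edges are treated as linear functionals on the algebra of polynomials
in two variables. To this end a function in `M_h` is replaced, on each edge, by a polynomial in the
plane with that restriction, chosen linearly (`edgeLift`).
-/

/-! ### A variational principle in finite dimensions -/

/-- A positive definite bilinear form on `ℝᵈ` is bounded below by a multiple of the squared norm. -/
theorem exists_pos_mul_sq_norm_le {d : ℕ} (B : (Fin d → ℝ) →ₗ[ℝ] (Fin d → ℝ) →ₗ[ℝ] ℝ)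
    (hpos : ∀ x, x ≠ 0 → 0 < B x x) : ∃ c > 0, ∀ x, c * ‖x‖ ^ 2 ≤ B x x := by
  have hcont : Continuous fun x => B x x :=
    B.toContinuousBilinearMap.continuous.clm_apply continuous_id
  have hscale : ∀ x : Fin d → ℝ, x ≠ 0 →
      ‖x‖⁻¹ • x ∈ Metric.sphere (0 : Fin d → ℝ) 1 := by
    intro x hx
    simp [norm_smul, hx]
  rcases (Metric.sphere (0 : Fin d → ℝ) 1).eq_empty_or_nonempty with h | h
  · refine ⟨1, one_pos, fun x => ?_⟩
    have hx : x = 0 := by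
      by_contra hx
      simpa [h] using hscale x hx
    simp [hx]
  · obtain ⟨x₀, hx₀, hmin⟩ :=
      (isCompact_sphere (0 : Fin d → ℝ) 1).exists_isMinOn h hcont.continuousOn
    refine ⟨B x₀ x₀, hpos _ (fun h0 => by simp [h0] at hx₀), fun x => ?_⟩
    by_cases hx : x = 0
    · simp [hx]
    have h1 : B x₀ x₀ ≤ B (‖x‖⁻¹ • x) (‖x‖⁻¹ • x) := hmin (hscale x hx)
    have hn : 0 < ‖x‖ := norm_pos_iff.mpr hx
    simp only [map_smul, LinearMap.smul_apply, smul_eq_mul] at h1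
    calc B x₀ x₀ * ‖x‖ ^ 2 ≤ (‖x‖⁻¹ * (‖x‖⁻¹ * B x x)) * ‖x‖ ^ 2 := by gcongr
      _ = B x x := by field_simp

/-- A functional that is quadratic with positive definite leading part, plus a nonnegative
continuous part, attains its minimum on `ℝᵈ`. -/
theorem exists_forall_le_quadratic_add {d : ℕ} (B : (Fin d → ℝ) →ₗ[ℝ] (Fin d → ℝ) →ₗ[ℝ] ℝ)
    (hpos : ∀ x, x ≠ 0 → 0 < B x x) (Γ : (Fin d → ℝ) → ℝ) (hΓ : ∀ x, 0 ≤ Γ x)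
    (hcont : Continuous Γ) (ℓ : (Fin d → ℝ) →ₗ[ℝ] ℝ) :
    ∃ x, ∀ y, B x x / 2 + Γ x - ℓ x ≤ B y y / 2 + Γ y - ℓ y := by
  obtain ⟨c, hc, hB⟩ := exists_pos_mul_sq_norm_le B hpos
  have hBc : Continuous fun x => B x x :=
    B.toContinuousBilinearMap.continuous.clm_apply continuous_id
  have hℓ : Continuous ℓ := ℓ.continuous_of_finiteDimensional
  have hJ : Continuous fun x => B x x / 2 + Γ x - ℓ x := ((hBc.div_const 2).add hcont).sub hℓ
  refine hJ.exists_forall_le ?_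
  -- Coercivity: the functional is at least `c ‖x‖² / 2 - ‖ℓ‖ ‖x‖`.
  set M := ‖LinearMap.toContinuousLinearMap ℓ‖
  have hM : ∀ x, ℓ x ≤ M * ‖x‖ := fun x =>
    (le_abs_self _).trans ((LinearMap.toContinuousLinearMap ℓ).le_opNorm x)
  have hlim : Filter.Tendsto (fun r : ℝ => r * (c / 2 * r - M)) Filter.atTop Filter.atTop :=
    Filter.tendsto_id.atTop_mul_atTop₀ (Filter.tendsto_atTop_add_const_right _ _
      (Filter.tendsto_id.const_mul_atTop (by positivity)))
  refine Filter.tendsto_atTop_mono (fun x => ?_) (hlim.comp (tendsto_norm_cocompact_atTop))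
  have := hB x
  have := hM x
  have := hΓ x
  simp only [Function.comp]
  nlinarith

/-- Let `B` be a symmetric positive definite form and `N` the monotone derivative of a nonnegative
potential `Γ`. Then the variational equation `B x y + N x y = ℓ y` for all `y` in a subspace `S`
has exactly one solution in `S`: the minimiser of `B x x / 2 + Γ x - ℓ x` over `S`. -/
theorem existsUnique_variational {H : Type*} [AddCommGroup H] [Module ℝ H]
    [FiniteDimensional ℝ H] (S : Submodule ℝ H) (B : H →ₗ[ℝ] H →ₗ[ℝ] ℝ)
    (hsymm : ∀ x y, B x y = B y x) (hpos : ∀ x, x ≠ 0 → 0 < B x x)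
    (Γ : H → ℝ) (hΓ : ∀ x, 0 ≤ Γ x)
    (hcont : ∀ (d : ℕ) (φ : (Fin d → ℝ) →ₗ[ℝ] H), Continuous fun y => Γ (φ y))
    (N : H → H → ℝ) (hder : ∀ x y, HasDerivAt (fun t : ℝ => Γ (x + t • y)) (N x y) 0)
    (hmono : ∀ x y, 0 ≤ N x (x - y) - N y (x - y)) (ℓ : H →ₗ[ℝ] ℝ) :
    ∃! x, x ∈ S ∧ ∀ y ∈ S, B x y + N x y = ℓ y := by
  refine existsUnique_of_exists_of_unique ?_ ?_
  · let e : S ≃ₗ[ℝ] (Fin (Module.finrank ℝ S) → ℝ) := (Module.finBasis ℝ S).equivFun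
    let φ : (Fin (Module.finrank ℝ S) → ℝ) →ₗ[ℝ] H := S.subtype ∘ₗ e.symm.toLinearMap
    have hφ : ∀ v, φ v = 0 → v = 0 := by
      intro v hv
      simpa [φ] using hv
    obtain ⟨v, hv⟩ := exists_forall_le_quadratic_add (B.compl₁₂ φ φ)
      (fun v hv => hpos _ (fun h => hv (hφ v h))) (fun v => Γ (φ v)) (fun v => hΓ _)
      (hcont _ φ) (ℓ ∘ₗ φ)
    have hmin : ∀ y ∈ S, B (φ v) (φ v) / 2 + Γ (φ v) - ℓ (φ v) ≤ B y y / 2 + Γ y - ℓ y := by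
      intro y hy
      simpa [φ] using hv (e ⟨y, hy⟩)
    have hvS : φ v ∈ S := by simp [φ]
    generalize φ v = x at hmin hvS
    refine ⟨x, hvS, fun y hy => ?_⟩
    -- The derivative of the functional in the direction `y` vanishes at the minimiser.
    have hloc : IsLocalMin (fun t : ℝ =>
        B (x + t • y) (x + t • y) / 2 + Γ (x + t • y) - ℓ (x + t • y)) 0 := by
      refine Filter.Eventually.of_forall fun t => ?_
      simpa using hmin (x + t • y) (S.add_mem hvS (S.smul_mem t hy))
    have hB : HasDerivAt (fun t : ℝ => B (x + t • y) (x + t • y) / 2) (B x y) 0 := by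
      have h1 : (fun t : ℝ => B (x + t • y) (x + t • y) / 2) =
          fun t => B x x / 2 + t * B x y + t ^ 2 * (B y y / 2) := by
        funext t
        simp [hsymm y x]
        ring
      rw [h1]
      have h2 := (((hasDerivAt_id (0 : ℝ)).mul_const (B x y)).const_add (B x x / 2)).add
        ((hasDerivAt_pow 2 (0 : ℝ)).mul_const (B y y / 2))
      exact h2.congr_deriv (by simp)
    have hl : HasDerivAt (fun t : ℝ => ℓ (x + t • y)) (ℓ y) 0 := by
      have h1 : (fun t : ℝ => ℓ (x + t • y)) = fun t => ℓ x + t * ℓ y := by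
        funext t
        simp
      rw [h1]
      simpa using ((hasDerivAt_id (0 : ℝ)).mul_const (ℓ y)).const_add (ℓ x)
    have h0 := hloc.hasDerivAt_eq_zero ((hB.add (hder x y)).sub hl)
    linarith
  · rintro x x' ⟨hx, h⟩ ⟨hx', h'⟩
    by_contra hne
    have h1 := h _ (S.sub_mem hx hx')
    have h2 := h' _ (S.sub_mem hx hx')
    have h3 := hpos _ (sub_ne_zero.mpr hne)
    have h4 := hmono x x'
    have h5 : B (x - x') (x - x') = B x (x - x') - B x' (x - x') := by simp
    linarith

namespace HDG

/-! ### Integrals over segments -/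

theorem inner_plane (u v : Plane) : ⟪u, v⟫ = u 0 * v 0 + u 1 * v 1 := by
  rw [EuclideanSpace.inner_eq_star_dotProduct]
  simp [dotProduct, Fin.sum_univ_two]
  ring

theorem norm_sq_plane (u : Plane) : ‖u‖ ^ 2 = u 0 ^ 2 + u 1 ^ 2 := by
  rw [← real_inner_self_eq_norm_sq, inner_plane]
  ring

theorem continuous_pval (p : MvPolynomial (Fin 2) ℝ) : Continuous (pval p) := by
  unfold pval
  exact (MvPolynomial.continuous_eval p).comp (by fun_prop)

/-- Integration with respect to arc length over a segment, in terms of its affine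
parametrisation. -/
theorem integral_seg {a b : Plane} (hab : a ≠ b) (f : Plane → ℝ) :
    ∫ x : Seg {a, b}, f x ∂(μH[1]) = ‖b - a‖ * ∫ t in (0 : ℝ)..1, f (a + t • (b - a)) := by
  set L := ‖b - a‖ with hL
  have hLpos : 0 < L := norm_pos_iff.mpr (sub_ne_zero.mpr hab.symm)
  set s : Set Plane := convexHull ℝ (({a, b} : Finset Plane) : Set Plane) with hs
  -- `γ` is the parametrisation by arc length, an isometry; it transports Lebesgue measure on `ℝ`,
  -- which is `μH[1]`, to `μH[1]` on its range.
  let γ : ℝ → Plane := fun t => a + t • (L⁻¹ • (b - a))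
  have hγ : Isometry γ := by
    refine Isometry.of_dist_eq fun x y => ?_
    simp only [γ, dist_add_left]
    rw [dist_eq_norm, ← sub_smul, norm_smul, norm_smul, norm_inv, norm_norm, ← hL,
      inv_mul_cancel₀ hLpos.ne', mul_one, dist_eq_norm]
  have hsγ : s = γ '' Set.Icc 0 L := by
    rw [hs, Finset.coe_pair, convexHull_pair, segment_eq_image']
    have h1 : Set.Icc 0 L = (fun t => L * t) '' Set.Icc (0 : ℝ) 1 := by
      rw [Set.image_mul_left_Icc hLpos.le zero_le_one]
      simp
    rw [h1, Set.image_image]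
    refine Set.image_congr fun t _ => ?_
    simp only [γ, smul_smul]
    congr 2
    field_simp
  have hmeas : MeasurableSet s := by
    rw [hsγ]
    exact (isCompact_Icc.image hγ.continuous).measurableSet
  have hpre : γ ⁻¹' s = Set.Icc 0 L := by
    rw [hsγ, Set.preimage_image_eq _ hγ.injective]
  have hemb : MeasurableEmbedding γ := hγ.isClosedEmbedding.measurableEmbedding
  calc ∫ x : s, f x ∂(μH[1])
      = ∫ y, f y ∂(Measure.map ((↑) : s → Plane) μH[1]) :=
        ((MeasurableEmbedding.subtype_coe hmeas).integral_map f).symm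
    _ = ∫ y in s, f y ∂(μH[1]) := by
        rw [isometry_subtype_coe.map_hausdorffMeasure (Or.inl zero_le_one), Subtype.range_coe]
    _ = ∫ y in s, f y ∂(Measure.map γ volume) := by
        rw [← hausdorffMeasure_real, hγ.map_hausdorffMeasure (Or.inl zero_le_one),
          Measure.restrict_restrict hmeas, Set.inter_eq_left.mpr]
        rw [hsγ]
        exact Set.image_subset_range _ _
    _ = ∫ t in Set.Icc 0 L, f (γ t) := by
        rw [hemb.setIntegral_map, hpre]
    _ = ∫ t in (0 : ℝ)..L, f (γ t) := by
        rw [integral_Icc_eq_integral_Ioc, intervalIntegral.integral_of_le hLpos.le]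
    _ = L * ∫ t in (0 : ℝ)..1, f (γ (L * t)) := by
        rw [intervalIntegral.integral_comp_mul_left (fun t => f (γ t)) hLpos.ne']
        simp only [mul_zero, mul_one, smul_eq_mul]
        field_simp
    _ = L * ∫ t in (0 : ℝ)..1, f (a + t • (b - a)) := by
        congr 1
        refine intervalIntegral.integral_congr fun t _ => ?_
        simp only [γ, smul_smul]
        congr 3
        field_simp

/-! ### The divergence theorem on a triangle -/

/-- A triangle is the image of the reference triangle under an affine map. -/
theorem convexHull_triple (a b c : Plane) :
    convexHull ℝ (({a, b, c} : Finset Plane) : Set Plane) =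
      (fun x : Plane => a + (x 0 • (b - a) + x 1 • (c - a))) ''
        {x | 0 ≤ x 0 ∧ 0 ≤ x 1 ∧ x 0 + x 1 ≤ 1} := by
  refine Set.Subset.antisymm ?_ ?_
  · refine convexHull_min ?_ ?_
    · intro y hy
      simp only [Finset.coe_insert, Finset.coe_singleton, Set.mem_insert_iff,
        Set.mem_singleton_iff] at hy
      rcases hy with rfl | rfl | rfl
      · exact ⟨0, by simp, by simp⟩
      · exact ⟨!₂[1, 0], by simp, by simp⟩
      · exact ⟨!₂[0, 1], by simp, by simp⟩
    · rintro _ ⟨x, ⟨hx0, hx1, hx2⟩, rfl⟩ _ ⟨y, ⟨hy0, hy1, hy2⟩, rfl⟩ r s hr hs hrs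
      refine ⟨r • x + s • y, ⟨?_, ?_, ?_⟩, ?_⟩
      · simp only [PiLp.add_apply, PiLp.smul_apply, smul_eq_mul]
        positivity
      · simp only [PiLp.add_apply, PiLp.smul_apply, smul_eq_mul]
        positivity
      · simp only [PiLp.add_apply, PiLp.smul_apply, smul_eq_mul]
        nlinarith
      · have ha : a = r • a + s • a := by rw [← add_smul, hrs, one_smul]
        simp only [PiLp.add_apply, PiLp.smul_apply, smul_eq_mul]
        nth_rewrite 1 [ha]
        module
  · rintro _ ⟨x, ⟨hx0, hx1, hx2⟩, rfl⟩
    have h := (convex_convexHull ℝ (({a, b, c} : Finset Plane) : Set Plane)).sum_mem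
      (t := Finset.univ) (w := ![1 - x 0 - x 1, x 0, x 1]) (z := ![a, b, c])
      (by
        intro i _
        fin_cases i <;> simp <;> linarith)
      (by
        simp only [Fin.sum_univ_three, Matrix.cons_val_zero, Matrix.cons_val_one,
          Matrix.cons_val]
        ring)
      (by
        intro i _
        apply subset_convexHull
        fin_cases i <;> simp)
    simp only [Fin.sum_univ_three, Matrix.cons_val_zero, Matrix.cons_val_one,
      Matrix.cons_val_two, Matrix.head_cons, Matrix.tail_cons] at h
    convert h using 1
    module

/-- The integral over a triangle in terms of the reference triangle. -/
theorem integral_triangle_eq (a b c : Plane)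
    (hD : (b 0 - a 0) * (c 1 - a 1) - (c 0 - a 0) * (b 1 - a 1) ≠ 0) (g : Plane → ℝ) :
    ∫ x in convexHull ℝ (({a, b, c} : Finset Plane) : Set Plane), g x =
      |(b 0 - a 0) * (c 1 - a 1) - (c 0 - a 0) * (b 1 - a 1)| *
        ∫ x in {x : Plane | 0 ≤ x 0 ∧ 0 ≤ x 1 ∧ x 0 + x 1 ≤ 1},
          g (a + (x 0 • (b - a) + x 1 • (c - a))) := by
  set D := (b 0 - a 0) * (c 1 - a 1) - (c 0 - a 0) * (b 1 - a 1) with hDdef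
  let L : Plane →L[ℝ] Plane :=
    (EuclideanSpace.proj (0 : Fin 2) : Plane →L[ℝ] ℝ).smulRight (b - a) +
      (EuclideanSpace.proj (1 : Fin 2) : Plane →L[ℝ] ℝ).smulRight (c - a)
  have hL : ∀ x, L x = x 0 • (b - a) + x 1 • (c - a) := fun x => by simp [L]
  have hdet : L.det = D := by
    rw [ContinuousLinearMap.det, ← LinearMap.det_toMatrix (EuclideanSpace.basisFun (Fin 2) ℝ).toBasis,
      Matrix.det_fin_two]
    simp [LinearMap.toMatrix_apply, hL, hDdef]
  have hclosed : IsClosed {x : Plane | 0 ≤ x 0 ∧ 0 ≤ x 1 ∧ x 0 + x 1 ≤ 1} := by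
    simp only [Set.ofPred_and]
    refine IsClosed.inter ?_ (IsClosed.inter ?_ ?_) <;>
      exact isClosed_le (by fun_prop) (by fun_prop)
  rw [convexHull_triple, integral_image_eq_integral_abs_det_fderiv_smul volume
    (f' := fun _ => L) hclosed.measurableSet, hdet]
  · simp only [smul_eq_mul]
    rw [integral_const_mul]
  · intro x _
    simp only [← hL]
    exact (L.hasFDerivAt.const_add a).hasFDerivWithinAt
  · intro x _ y _ hxy
    simp only [add_right_inj] at hxy
    have h0 := congrArg (fun z : Plane => z 0) hxy
    have h1 := congrArg (fun z : Plane => z 1) hxy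
    simp only [PiLp.add_apply, PiLp.smul_apply, PiLp.sub_apply, smul_eq_mul] at h0 h1
    have e0 : (x 0 - y 0) * D = 0 := by
      rw [hDdef]
      linear_combination (c 1 - a 1) * h0 - (c 0 - a 0) * h1
    have e1 : (x 1 - y 1) * D = 0 := by
      rw [hDdef]
      linear_combination (b 0 - a 0) * h1 - (b 1 - a 1) * h0
    ext i
    fin_cases i
    · simpa [hD, sub_eq_zero] using e0
    · simpa [hD, sub_eq_zero] using e1

/-- Fubini's theorem on the reference triangle. -/
theorem integral_refTriangle (h : Plane → ℝ) (hh : Continuous h) :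
    ∫ x in {x : Plane | 0 ≤ x 0 ∧ 0 ≤ x 1 ∧ x 0 + x 1 ≤ 1}, h x =
      ∫ t in (0 : ℝ)..1, ∫ s in (0 : ℝ)..(1 - t), h !₂[s, t] := by
  let ψ : Plane ≃ᵐ ℝ × ℝ :=
    (MeasurableEquiv.toLp 2 (Fin 2 → ℝ)).symm.trans MeasurableEquiv.finTwoArrow
  have hψ : MeasurePreserving ψ volume volume :=
    (EuclideanSpace.volume_preserving_symm_measurableEquiv_toLp (Fin 2)).trans
      (volume_preserving_finTwoArrow ℝ)
  let A : Set (ℝ × ℝ) := {z | 0 ≤ z.1 ∧ 0 ≤ z.2 ∧ z.1 + z.2 ≤ 1}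
  have hA : IsClosed A := by
    simp only [A, Set.ofPred_and]
    refine IsClosed.inter ?_ (IsClosed.inter ?_ ?_) <;>
      exact isClosed_le (by fun_prop) (by fun_prop)
  have hAc : IsCompact A := by
    refine (isCompact_Icc (a := ((0 : ℝ), (0 : ℝ))) (b := (1, 1))).of_isClosed_subset hA ?_
    rintro ⟨s, t⟩ ⟨h1, h2, h3⟩
    simp only at h1 h2 h3
    exact ⟨⟨h1, h2⟩, ⟨by simp only; linarith, by simp only; linarith⟩⟩
  have hpre : ψ ⁻¹' A = {x : Plane | 0 ≤ x 0 ∧ 0 ≤ x 1 ∧ x 0 + x 1 ≤ 1} := rfl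
  let h' : ℝ × ℝ → ℝ := fun z => h !₂[z.1, z.2]
  have hh' : Continuous h' := by
    refine hh.comp ((PiLp.continuous_toLp 2 _).comp ?_)
    refine continuous_pi fun i => ?_
    fin_cases i
    · exact continuous_fst
    · exact continuous_snd
  have hcomp : ∀ x, h' (ψ x) = h x := by
    intro x
    have : (!₂[(ψ x).1, (ψ x).2] : Plane) = x := by
      ext i
      fin_cases i <;> rfl
    simp only [h', this]
  calc ∫ x in {x : Plane | 0 ≤ x 0 ∧ 0 ≤ x 1 ∧ x 0 + x 1 ≤ 1}, h x
      = ∫ x in ψ ⁻¹' A, h' (ψ x) := by simp only [hcomp, hpre]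
    _ = ∫ z in A, h' z := hψ.setIntegral_preimage_emb ψ.measurableEmbedding h' A
    _ = ∫ z, A.indicator h' z := (integral_indicator hA.measurableSet).symm
    _ = ∫ t : ℝ, ∫ s : ℝ, A.indicator h' (s, t) := by
        refine integral_prod_symm _ ?_
        exact (integrable_indicator_iff hA.measurableSet).mpr
          (hh'.continuousOn.integrableOn_compact hAc)
    _ = ∫ t : ℝ, (Set.Icc (0 : ℝ) 1).indicator
          (fun t => ∫ s in (0 : ℝ)..(1 - t), h !₂[s, t]) t := by
        congr 1
        funext t
        by_cases ht : t ∈ Set.Icc (0 : ℝ) 1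
        · rw [Set.indicator_of_mem ht, intervalIntegral.integral_of_le (by linarith [ht.2]),
            ← integral_Icc_eq_integral_Ioc, ← integral_indicator measurableSet_Icc]
          congr 1
          funext s
          have : (s, t) ∈ A ↔ s ∈ Set.Icc 0 (1 - t) := by
            simp only [A, Set.mem_ofPred_eq, Set.mem_Icc]
            constructor
            · rintro ⟨h1, h2, h3⟩
              exact ⟨h1, by linarith⟩
            · rintro ⟨h1, h2⟩
              exact ⟨h1, ht.1, by linarith⟩
          by_cases hs : (s, t) ∈ A
          · rw [Set.indicator_of_mem hs, Set.indicator_of_mem (this.mp hs)]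
          · rw [Set.indicator_of_notMem hs, Set.indicator_of_notMem (fun h => hs (this.mpr h))]
        · rw [Set.indicator_of_notMem ht]
          have : ∀ s, A.indicator h' (s, t) = 0 := by
            intro s
            refine Set.indicator_of_notMem (fun hs => ht ?_) _
            obtain ⟨h1, h2, h3⟩ := hs
            simp only at h1 h2 h3
            exact ⟨h2, by linarith⟩
          simp [this]
    _ = ∫ t in (0 : ℝ)..1, ∫ s in (0 : ℝ)..(1 - t), h !₂[s, t] := by
        rw [integral_indicator measurableSet_Icc, integral_Icc_eq_integral_Ioc,
          intervalIntegral.integral_of_le zero_le_one]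

theorem hasDerivAt_pval_line (p : MvPolynomial (Fin 2) ℝ) (x d : Plane) (s : ℝ) :
    HasDerivAt (fun s : ℝ => pval p (x + s • d))
      (∑ i, d i * pval (MvPolynomial.pderiv i p) (x + s • d)) s := by
  induction p using MvPolynomial.induction_on with
  | C r => simpa [pval] using hasDerivAt_const s r
  | add p q hp hq =>
    simp only [pval, map_add, mul_add, Finset.sum_add_distrib] at *
    exact hp.add hq
  | mul_X p i hp =>
    have hX : HasDerivAt (fun s : ℝ => (x + s • d) i) (d i) s := by
      simpa using ((hasDerivAt_id s).mul_const (d i)).const_add (x i)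
    have := hp.mul hX
    have h1 : (fun s : ℝ => pval (p * MvPolynomial.X i) (x + s • d)) =
        (fun s : ℝ => pval p (x + s • d)) * fun s => (x + s • d) i := by
      funext s
      simp [pval]
    rw [h1]
    refine this.congr_deriv ?_
    simp only [pval, Derivation.leibniz, MvPolynomial.pderiv_X, smul_eq_mul, map_add, map_mul,
      MvPolynomial.eval_X, mul_add, Finset.sum_add_distrib]
    fin_cases i <;> simp [Fin.sum_univ_two, Pi.single_apply] <;> ring

/-- The integral over a triangle of the derivative in the direction of the side from `a` to `b`: the
fundamental theorem of calculus on the segments parallel to that side, which run from the side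
`ac` to the side `bc`. -/
theorem integral_triangle_deriv (a b c : Plane)
    (hD : (b 0 - a 0) * (c 1 - a 1) - (c 0 - a 0) * (b 1 - a 1) ≠ 0)
    (p : MvPolynomial (Fin 2) ℝ) :
    ∫ x in convexHull ℝ (({a, b, c} : Finset Plane) : Set Plane),
        ∑ i, (b - a) i * pval (MvPolynomial.pderiv i p) x =
      |(b 0 - a 0) * (c 1 - a 1) - (c 0 - a 0) * (b 1 - a 1)| *
        ((∫ t in (0 : ℝ)..1, pval p (b + t • (c - b))) -
          ∫ t in (0 : ℝ)..1, pval p (a + t • (c - a))) := by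
  have hc : ∀ q, Continuous (pval q) := continuous_pval
  rw [integral_triangle_eq a b c hD, integral_refTriangle, ← intervalIntegral.integral_sub]
  · congr 1
    refine intervalIntegral.integral_congr fun t _ => ?_
    simp only [Matrix.cons_val_zero, Matrix.cons_val_one]
    have hl : ∀ s : ℝ, a + (s • (b - a) + t • (c - a)) = (a + t • (c - a)) + s • (b - a) :=
      fun s => by module
    simp only [hl]
    rw [intervalIntegral.integral_eq_sub_of_hasDerivAt
      (fun s _ => hasDerivAt_pval_line p (a + t • (c - a)) (b - a) s)]
    · congr 2
      · module
      · module
    · refine Continuous.intervalIntegrable ?_ _ _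
      fun_prop
  · exact Continuous.intervalIntegrable (by fun_prop) _ _
  · exact Continuous.intervalIntegrable (by fun_prop) _ _
  · fun_prop

/-- A unit vector `n` normal to `w` pairs with `u` to the height, over the base `w`, of the
parallelogram spanned by `u` and `w`. -/
theorem abs_inner_mul_norm_eq (n u w : Plane) (hn : ‖n‖ = 1) (hw : ⟪n, w⟫ = 0) :
    |⟪n, u⟫| * ‖w‖ = |u 0 * w 1 - w 0 * u 1| := by
  have hn2 : n 0 ^ 2 + n 1 ^ 2 = 1 := by rw [← norm_sq_plane, hn, one_pow]
  rw [inner_plane] at hw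
  have h0 : w 0 = -(n 0 * w 1 - n 1 * w 0) * n 1 := by linear_combination n 0 * hw - w 0 * hn2
  have h1 : w 1 = (n 0 * w 1 - n 1 * w 0) * n 0 := by linear_combination n 1 * hw - w 1 * hn2
  rw [← abs_of_nonneg (norm_nonneg w), ← abs_mul]
  refine (sq_eq_sq_iff_abs_eq_abs _ _).mp ?_
  rw [mul_pow, norm_sq_plane, inner_plane]
  generalize n 0 * w 1 - n 1 * w 0 = k at h0 h1
  rw [h0, h1]
  linear_combination (n 0 * u 0 + n 1 * u 1) ^ 2 * k ^ 2 * hn2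

theorem sum_powersetCard_two {a b c : Plane} (hab : a ≠ b) (hac : a ≠ c) (hbc : b ≠ c)
    (f : Finset Plane → ℝ) :
    ∑ e ∈ Finset.powersetCard 2 {a, b, c}, f e = f {b, c} + f {a, c} + f {a, b} := by
  have h1 : ({a, b} : Finset Plane) ≠ {a, c} := by
    intro h
    have : b ∈ ({a, c} : Finset Plane) := h ▸ (by simp)
    simp [hab.symm, hbc] at this
  have h2 : ({b, c} : Finset Plane) ≠ {a, c} := by
    intro h
    have : b ∈ ({a, c} : Finset Plane) := h ▸ (by simp)
    simp [hab.symm, hbc] at this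
  have h3 : ({b, c} : Finset Plane) ≠ {a, b} := by
    intro h
    have : c ∈ ({a, b} : Finset Plane) := h ▸ (by simp)
    simp [hac.symm, hbc.symm] at this
  have h : Finset.powersetCard 2 ({a, b, c} : Finset Plane) = {{b, c}, {a, c}, {a, b}} := by
    refine (Finset.eq_of_subset_of_card_le ?_ ?_).symm
    · intro e he
      simp only [Finset.mem_insert, Finset.mem_singleton] at he
      rcases he with rfl | rfl | rfl
      · simp [Finset.mem_powersetCard, Finset.card_pair hbc]
      · rw [Finset.mem_powersetCard, Finset.card_pair hac]
        refine ⟨?_, rfl⟩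
        intro x
        simp
        tauto
      · rw [Finset.mem_powersetCard, Finset.card_pair hab]
        refine ⟨?_, rfl⟩
        intro x
        simp
        tauto
    · rw [Finset.card_powersetCard, Finset.card_eq_three.mpr ⟨a, b, c, hab, hac, hbc, rfl⟩]
      exact (Finset.card_eq_three.mpr ⟨{b, c}, {a, c}, {a, b}, h2, h3, h1.symm, rfl⟩).ge
  rw [h, Finset.sum_insert (by simp [h2, h3]), Finset.sum_insert (by simp [h1.symm]),
    Finset.sum_singleton, add_assoc]

/-- The divergence theorem on a triangle, for a constant vector field times a polynomial, the
vector being one of the sides. -/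
theorem sum_side_mul_integral_triangle {a b c : Plane} (hab : a ≠ b) (hac : a ≠ c) (hbc : b ≠ c)
    (hD : (b 0 - a 0) * (c 1 - a 1) - (c 0 - a 0) * (b 1 - a 1) ≠ 0)
    (hn : ∀ e ⊆ ({a, b, c} : Finset Plane), e.card = 2 →
      IsOutwardNormal {a, b, c} e (outwardNormal {a, b, c} e))
    (p : MvPolynomial (Fin 2) ℝ) :
    ∑ i, (b - a) i * ∫ x in convexHull ℝ (({a, b, c} : Finset Plane) : Set Plane),
        pval (MvPolynomial.pderiv i p) x =
      ∑ e ∈ Finset.powersetCard 2 {a, b, c},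
        ⟪outwardNormal {a, b, c} e, b - a⟫ * ∫ x : Seg e, pval p x ∂(μH[1]) := by
  set T : Finset Plane := {a, b, c} with hT
  have hcomp : IsCompact (convexHull ℝ (T : Set Plane)) := T.finite_toSet.isCompact_convexHull ℝ
  have hl : ∑ i, (b - a) i * ∫ x in convexHull ℝ (T : Set Plane),
      pval (MvPolynomial.pderiv i p) x = ∫ x in convexHull ℝ (T : Set Plane),
        ∑ i, (b - a) i * pval (MvPolynomial.pderiv i p) x := by
    rw [integral_finsetSum]
    · simp only [integral_const_mul]
    · intro i _
      exact ((continuous_const.mul (continuous_pval _)).continuousOn).integrableOn_compact hcomp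
  rw [hl, integral_triangle_deriv a b c hD, sum_powersetCard_two hab hac hbc,
    integral_seg hab, integral_seg hac, integral_seg hbc]
  obtain ⟨hn1, hn2, hn3⟩ := hn {b, c} (by rw [hT]; intro x; simp; tauto) (Finset.card_pair hbc)
  obtain ⟨hm1, hm2, hm3⟩ := hn {a, c} (by rw [hT]; intro x; simp; tauto) (Finset.card_pair hac)
  obtain ⟨hk1, hk2, hk3⟩ := hn {a, b} (by rw [hT]; intro x; simp; tauto) (Finset.card_pair hab)
  -- With weights base times height, the sides `bc` and `ac` carry twice the area of the triangle,
  -- with opposite signs, and the side `ab` is parallel to the direction.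
  have e1 : ⟪outwardNormal T {b, c}, b - a⟫ * ‖c - b‖ =
      |(b 0 - a 0) * (c 1 - a 1) - (c 0 - a 0) * (b 1 - a 1)| := by
    have hpos : 0 < ⟪outwardNormal T {b, c}, b - a⟫ := by
      have := hn3 b (by simp) a (by simp [hT]) (by simp [hab, hac])
      rw [← neg_sub, inner_neg_right] at this
      linarith
    have := abs_inner_mul_norm_eq _ (b - a) (c - b) hn1 (hn2 b (by simp) c (by simp))
    rw [abs_of_pos hpos] at this
    rw [this]
    congr 1
    simp only [PiLp.sub_apply]
    ring
  have e2 : ⟪outwardNormal T {a, c}, b - a⟫ * ‖c - a‖ =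
      -|(b 0 - a 0) * (c 1 - a 1) - (c 0 - a 0) * (b 1 - a 1)| := by
    have hneg := hm3 a (by simp) b (by simp [hT]) (by simp [hab.symm, hbc])
    have := abs_inner_mul_norm_eq _ (b - a) (c - a) hm1 (hm2 a (by simp) c (by simp))
    rw [abs_of_neg hneg, neg_mul, neg_eq_iff_eq_neg] at this
    rw [this]
    simp only [PiLp.sub_apply]
  have e3 : ⟪outwardNormal T {a, b}, b - a⟫ = 0 := hk2 a (by simp) b (by simp)
  rw [← mul_assoc, ← mul_assoc, e1, e2, e3]
  ring

/-- The divergence theorem on a triangle, for polynomials. Both sides are linear in the direction,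
so it suffices to have it for two sides of the triangle. -/
theorem integral_triangle_pderiv {T : Finset Plane} (hT : T.card = 3)
    (hind : AffineIndependent ℝ ((↑) : T → Plane)) (p : MvPolynomial (Fin 2) ℝ) (i : Fin 2) :
    ∫ x in convexHull ℝ (T : Set Plane), pval (MvPolynomial.pderiv i p) x =
      ∑ e ∈ T.powersetCard 2, outwardNormal T e i * ∫ x : Seg e, pval p x ∂(μH[1]) := by
  have hn : ∀ e ⊆ T, e.card = 2 → IsOutwardNormal T e (outwardNormal T e) := fun e heT he =>
    isOutwardNormal_outwardNormal hT hind heT he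
  obtain ⟨a, b, c, hab, hac, hbc, rfl⟩ := Finset.card_eq_three.mp hT
  -- The area is nonzero because the height over the base `bc` is.
  have hD : (b 0 - a 0) * (c 1 - a 1) - (c 0 - a 0) * (b 1 - a 1) ≠ 0 := by
    obtain ⟨h1, h2, h3⟩ := hn {b, c} (by intro x; simp; tauto) (Finset.card_pair hbc)
    have h := abs_inner_mul_norm_eq _ (a - b) (c - b) h1 (h2 b (by simp) c (by simp))
    have hneg := h3 b (by simp) a (by simp) (by simp [hab, hac])
    have hpos : 0 < |⟪outwardNormal {a, b, c} {b, c}, a - b⟫| * ‖c - b‖ :=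
      mul_pos (abs_pos.mpr hneg.ne) (norm_pos_iff.mpr (sub_ne_zero.mpr hbc.symm))
    rw [h, abs_pos] at hpos
    intro h0
    apply hpos
    simp only [PiLp.sub_apply]
    linear_combination -h0
  have hb := sum_side_mul_integral_triangle hab hac hbc hD hn p
  have hperm : ({a, c, b} : Finset Plane) = {a, b, c} := by
    rw [Finset.pair_comm]
  have hc := sum_side_mul_integral_triangle hac hab hbc.symm
    (by intro h0; apply hD; linear_combination -h0) (by rw [hperm]; exact hn) p
  rw [hperm] at hc
  set T : Finset Plane := {a, b, c}
  set J : Fin 2 → ℝ := fun i =>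
    ∑ e ∈ T.powersetCard 2, outwardNormal T e i * ∫ x : Seg e, pval p x ∂(μH[1]) with hJ
  have hsum : ∀ d : Plane, ∑ e ∈ T.powersetCard 2,
      ⟪outwardNormal T e, d⟫ * ∫ x : Seg e, pval p x ∂(μH[1]) = d 0 * J 0 + d 1 * J 1 := by
    intro d
    rw [hJ, Finset.mul_sum, Finset.mul_sum, ← Finset.sum_add_distrib]
    refine Finset.sum_congr rfl fun e _ => ?_
    rw [inner_plane]
    ring
  rw [hsum, Fin.sum_univ_two] at hb hc
  simp only [PiLp.sub_apply] at hb hc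
  change _ = J i
  refine mul_left_cancel₀ hD ?_
  fin_cases i
  · change _ * (∫ x in convexHull ℝ (T : Set Plane), pval (MvPolynomial.pderiv 0 p) x) = _ * J 0
    linear_combination (c 1 - a 1) * hb - (b 1 - a 1) * hc
  · change _ * (∫ x in convexHull ℝ (T : Set Plane), pval (MvPolynomial.pderiv 1 p) x) = _ * J 1
    linear_combination (b 0 - a 0) * hc - (c 0 - a 0) * hb

/-! ### Integrals of polynomials over triangles and edges -/

theorem integrableOn_pval (T : Finset Plane) (p : MvPolynomial (Fin 2) ℝ) :
    IntegrableOn (pval p) (convexHull ℝ (T : Set Plane)) :=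
  (continuous_pval p).continuousOn.integrableOn_compact (T.finite_toSet.isCompact_convexHull ℝ)

/-- The integral of a polynomial over a triangle, as a linear functional. -/
noncomputable def triInt (T : Finset Plane) : MvPolynomial (Fin 2) ℝ →ₗ[ℝ] ℝ where
  toFun p := ∫ x in convexHull ℝ (T : Set Plane), pval p x
  map_add' p q := by
    rw [← integral_add (integrableOn_pval T p) (integrableOn_pval T q)]
    simp [pval]
  map_smul' r p := by
    rw [RingHom.id_apply, smul_eq_mul, ← integral_const_mul]
    simp [pval]

/-- The integral of a polynomial over an edge, as a linear functional. The hypothesis on the number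
of vertices makes the set an honest segment, of finite length, so that all polynomials are
integrable. -/
noncomputable def segInt (e : Finset Plane) (he : e.card = 2) : MvPolynomial (Fin 2) ℝ →ₗ[ℝ] ℝ where
  toFun p := ∫ x : Seg e, pval p x ∂(μH[1])
  map_add' p q := by
    obtain ⟨a, b, hab, rfl⟩ := Finset.card_eq_two.mp he
    have hp := continuous_pval p
    have hq := continuous_pval q
    rw [integral_seg hab, integral_seg hab, integral_seg hab, ← mul_add,
      ← intervalIntegral.integral_add (Continuous.intervalIntegrable (by fun_prop) _ _)
        (Continuous.intervalIntegrable (by fun_prop) _ _)]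
    simp [pval]
  map_smul' r p := by
    rw [RingHom.id_apply, smul_eq_mul, ← integral_const_mul]
    simp [pval]

theorem triInt_apply (T : Finset Plane) (p : MvPolynomial (Fin 2) ℝ) :
    triInt T p = ∫ x in convexHull ℝ (T : Set Plane), pval p x := rfl

theorem segInt_apply (e : Finset Plane) (he : e.card = 2) (p : MvPolynomial (Fin 2) ℝ) :
    segInt e he p = ∫ x : Seg e, pval p x ∂(μH[1]) := rfl

theorem triInt_nonneg (T : Finset Plane) {p : MvPolynomial (Fin 2) ℝ} (hp : ∀ x, 0 ≤ pval p x) :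
    0 ≤ triInt T p :=
  integral_nonneg hp

theorem pval_mul_self_nonneg (p : MvPolynomial (Fin 2) ℝ) (x : Plane) : 0 ≤ pval (p * p) x := by
  simpa [pval] using mul_self_nonneg _

theorem segInt_mul_self_nonneg (e : Finset Plane) (he : e.card = 2)
    (p : MvPolynomial (Fin 2) ℝ) : 0 ≤ segInt e he (p * p) :=
  integral_nonneg fun x => pval_mul_self_nonneg p x

theorem triInt_mul_self_nonneg (T : Finset Plane) (p : MvPolynomial (Fin 2) ℝ) :
    0 ≤ triInt T (p * p) :=
  triInt_nonneg T (pval_mul_self_nonneg p)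

/-- A polynomial vanishing on a nonempty open set is zero. -/
theorem eq_zero_of_pval_eq_zero_on {U : Set Plane} (hU : IsOpen U) (hne : U.Nonempty)
    {p : MvPolynomial (Fin 2) ℝ} (hp : ∀ x ∈ U, pval p x = 0) : p = 0 := by
  obtain ⟨x, hx⟩ := hne
  have hU' : IsOpen (WithLp.toLp 2 ⁻¹' U : Set (Fin 2 → ℝ)) :=
    hU.preimage (PiLp.continuous_toLp 2 _)
  obtain ⟨ε, hε, hball⟩ := Metric.isOpen_iff.mp hU' (fun i => x i) hx
  rw [ball_pi _ hε] at hball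
  refine MvPolynomial.funext_set (fun i => Metric.ball (x i) ε) (fun i => ?_) fun y hy => ?_
  · rw [Real.ball_eq_Ioo]
    exact Set.Ioo_infinite (by linarith)
  · rw [map_zero]
    exact hp _ (hball hy)

theorem eq_zero_of_triInt_mul_self_eq_zero {T : Finset Plane} (hT : T.card = 3)
    (hind : AffineIndependent ℝ ((↑) : T → Plane)) {p : MvPolynomial (Fin 2) ℝ}
    (hp : triInt T (p * p) = 0) : p = 0 := by
  have hint : (interior (convexHull ℝ (T : Set Plane))).Nonempty := by
    rw [interior_convexHull_nonempty_iff_affineSpan_eq_top]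
    have := (hind.affineSpan_eq_top_iff_card_eq_finrank_add_one).mpr (by simp [hT])
    simpa using this
  rw [triInt_apply, setIntegral_eq_zero_iff_of_nonneg_ae
    (Filter.Eventually.of_forall (pval_mul_self_nonneg p)) (integrableOn_pval T _)] at hp
  refine eq_zero_of_pval_eq_zero_on isOpen_interior hint fun x hx => ?_
  have h1 : pval (p * p) =ᵐ[volume.restrict (interior (convexHull ℝ (T : Set Plane)))] 0 :=
    ae_restrict_of_ae_restrict_of_subset interior_subset hp
  have h2 := Measure.eqOn_open_of_ae_eq h1 isOpen_interior (continuous_pval _).continuousOn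
    continuousOn_const hx
  simpa [pval] using h2

theorem pval_eq_zero_of_segInt_mul_self_eq_zero {e : Finset Plane} (he : e.card = 2)
    {p : MvPolynomial (Fin 2) ℝ} (hp : segInt e he (p * p) = 0) (x : Seg e) :
    pval p x = 0 := by
  obtain ⟨a, b, hab, rfl⟩ := Finset.card_eq_two.mp he
  obtain ⟨x, hx⟩ := x
  rw [segInt_apply, integral_seg hab,
    mul_eq_zero_iff_left (norm_pos_iff.mpr (sub_ne_zero.mpr hab.symm)).ne'] at hp
  rw [Finset.coe_pair, convexHull_pair, segment_eq_image'] at hx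
  obtain ⟨t, ht, rfl⟩ := hx
  by_contra hne
  refine (intervalIntegral.integral_pos (f := fun t : ℝ => pval (p * p) (a + t • (b - a)))
    zero_lt_one ?_ (fun t _ => pval_mul_self_nonneg p _) ⟨t, ht, ?_⟩).ne' hp
  · have := continuous_pval (p * p)
    exact Continuous.continuousOn (by fun_prop)
  · have : pval (p * p) (a + t • (b - a)) =
      pval p (a + t • (b - a)) * pval p (a + t • (b - a)) := by simp [pval]
    rw [this]
    exact mul_self_pos.mpr hne

/-! ### The forms of the scheme in terms of polynomials -/

/-- The bilinear form `(x, y) ↦ I (A x * B y)` obtained from a linear functional `I` on polynomials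
and two linear maps into polynomials. -/
noncomputable def mulForm {E E' : Type*} [AddCommGroup E] [Module ℝ E] [AddCommGroup E']
    [Module ℝ E'] (I : MvPolynomial (Fin 2) ℝ →ₗ[ℝ] ℝ) (A : E →ₗ[ℝ] MvPolynomial (Fin 2) ℝ)
    (B : E' →ₗ[ℝ] MvPolynomial (Fin 2) ℝ) : E →ₗ[ℝ] E' →ₗ[ℝ] ℝ :=
  ((LinearMap.mul ℝ (MvPolynomial (Fin 2) ℝ)).compr₂ I).compl₁₂ A B

@[simp]
theorem mulForm_apply {E E' : Type*} [AddCommGroup E] [Module ℝ E] [AddCommGroup E']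
    [Module ℝ E'] (I : MvPolynomial (Fin 2) ℝ →ₗ[ℝ] ℝ) (A : E →ₗ[ℝ] MvPolynomial (Fin 2) ℝ)
    (B : E' →ₗ[ℝ] MvPolynomial (Fin 2) ℝ) (x : E) (y : E') :
    mulForm I A B x y = I (A x * B y) := rfl

instance finiteDimensional_edgePoly (k : ℕ) (e : Finset Plane) :
    FiniteDimensional ℝ (edgePoly k e) := by
  unfold edgePoly
  infer_instance

/-- Polynomial functions on an edge extend linearly to polynomials in the plane. -/
theorem exists_edgeLift (k : ℕ) (e : Finset Plane) :
    ∃ L : edgePoly k e →ₗ[ℝ] MvPolynomial (Fin 2) ℝ, ∀ μ (x : Seg e), pval (L μ) x = μ.1 x := by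
  have hsurj : Function.Surjective ((restrictToEdge e).submoduleMap
      (MvPolynomial.restrictTotalDegree (Fin 2) ℝ k)) := LinearMap.submoduleMap_surjective _ _
  obtain ⟨g, hg⟩ := LinearMap.exists_rightInverse_of_surjective _ (LinearMap.range_eq_top.mpr hsurj)
  refine ⟨(Submodule.subtype _) ∘ₗ g, fun μ x => ?_⟩
  have h := congrArg Subtype.val (LinearMap.congr_fun hg μ)
  exact congrFun h x

/-- A linear choice of a polynomial in the plane with prescribed restriction to an edge. -/
noncomputable def edgeLift (k : ℕ) (e : Finset Plane) :
    edgePoly k e →ₗ[ℝ] MvPolynomial (Fin 2) ℝ :=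
  (exists_edgeLift k e).choose

theorem pval_edgeLift {k : ℕ} {e : Finset Plane} (μ : edgePoly k e) (x : Seg e) :
    pval (edgeLift k e μ) x = μ.1 x :=
  (exists_edgeLift k e).choose_spec μ x

namespace Triangulation

variable {Ω : Set Plane} {𝒯 : Triangulation Ω} {k : ℕ}

theorem card_edge (e : 𝒯.Edge) : e.1.card = 2 := by
  obtain ⟨e, he⟩ := e
  simp only [edges, Finset.mem_biUnion, Finset.mem_powersetCard] at he
  obtain ⟨T, -, -, h⟩ := he
  exact h

theorem exists_elem_of_edge (e : 𝒯.Edge) : ∃ T : 𝒯.Elem, e.1 ⊆ T.1 := by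
  obtain ⟨e, he⟩ := e
  simp only [edges, Finset.mem_biUnion, Finset.mem_powersetCard] at he
  obtain ⟨T, hT, h, -⟩ := he
  exact ⟨⟨T, hT⟩, h⟩

/-- The integral of a polynomial over an edge of the triangulation. -/
noncomputable def edgeInt (e : 𝒯.Edge) : MvPolynomial (Fin 2) ℝ →ₗ[ℝ] ℝ :=
  segInt e.1 (card_edge e)

variable (𝒯) in
open scoped Classical in
/-- The pairs of an element and one of its sides, the index set of `∑_K ∑_{E ⊆ ∂K}`. -/
noncomputable def incidences : Finset (𝒯.Elem × 𝒯.Edge) :=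
  Finset.univ.filter fun z => z.2.1 ⊆ z.1.1

theorem mem_incidences {z : 𝒯.Elem × 𝒯.Edge} : z ∈ 𝒯.incidences ↔ z.2.1 ⊆ z.1.1 := by
  simp [incidences]

open scoped Classical in
theorem sum_incidences (f : 𝒯.Elem → 𝒯.Edge → ℝ) :
    ∑ z ∈ 𝒯.incidences, f z.1 z.2 = ∑ T : 𝒯.Elem, ∑ e : 𝒯.Edge with e.1 ⊆ T.1, f T e := by
  rw [incidences, Finset.sum_filter, ← Finset.univ_product_univ, Finset.sum_product]
  simp only [Finset.sum_filter]

open scoped Classical in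
theorem sum_incidences_right (f : 𝒯.Elem → 𝒯.Edge → ℝ) :
    ∑ z ∈ 𝒯.incidences, f z.1 z.2 = ∑ e : 𝒯.Edge, ∑ T : 𝒯.Elem with e.1 ⊆ T.1, f T e := by
  rw [incidences, Finset.sum_filter, ← Finset.univ_product_univ, Finset.sum_product_right]
  simp only [Finset.sum_filter]

/-- The divergence theorem, summed over all elements. -/
theorem sum_triInt_pderiv (p : 𝒯.Elem → Fin 2 → MvPolynomial (Fin 2) ℝ) :
    ∑ T, ∑ i, triInt T.1 (MvPolynomial.pderiv i (p T i)) =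
      ∑ z ∈ 𝒯.incidences, ∑ i, outwardNormal z.1.1 z.2.1 i * edgeInt z.2 (p z.1 i) := by
  classical
  rw [sum_incidences fun T e => ∑ i, outwardNormal T.1 e.1 i * edgeInt e (p T i)]
  refine Finset.sum_congr rfl fun T _ => ?_
  rw [Finset.sum_comm]
  refine Finset.sum_congr rfl fun i _ => ?_
  rw [triInt_apply, integral_triangle_pderiv (𝒯.card_eq T.1 T.2) (𝒯.nondegenerate T.1 T.2)]
  symm
  refine Finset.sum_bij (fun e _ => e.1) ?_ ?_ ?_ ?_
  · intro e he
    rw [Finset.mem_powersetCard]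
    exact ⟨by simpa using he, card_edge e⟩
  · intro e _ e' _ h
    exact Subtype.ext h
  · intro e he
    refine ⟨⟨e, ?_⟩, ?_, rfl⟩
    · simp only [edges, Finset.mem_biUnion]
      exact ⟨T.1, T.2, he⟩
    · simpa using (Finset.mem_powersetCard.mp he).1
  · intro e _
    rfl

/-- The polynomial `U|_K`. -/
noncomputable def uPoly (T : 𝒯.Elem) : 𝒯.W k →ₗ[ℝ] MvPolynomial (Fin 2) ℝ :=
  Submodule.subtype _ ∘ₗ LinearMap.proj T

/-- The `i`-th component of the polynomial vector field `Q|_K`. -/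
noncomputable def qPoly (T : 𝒯.Elem) (i : Fin 2) : 𝒯.V k →ₗ[ℝ] MvPolynomial (Fin 2) ℝ :=
  Submodule.subtype _ ∘ₗ LinearMap.proj i ∘ₗ LinearMap.proj T

/-- A polynomial in the plane that restricts to `μ` on the edge `e`. -/
noncomputable def mPoly (e : 𝒯.Edge) : 𝒯.M k →ₗ[ℝ] MvPolynomial (Fin 2) ℝ :=
  edgeLift k e.1 ∘ₗ LinearMap.proj e

theorem uval_eq (w : 𝒯.W k) (T : 𝒯.Elem) (x : Plane) : uval w T x = pval (uPoly T w) x := rfl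

theorem vval_eq (v : 𝒯.V k) (T : 𝒯.Elem) (i : Fin 2) (x : Plane) :
    vval v T i x = pval (qPoly T i v) x := rfl

theorem mval_eq (μ : 𝒯.M k) (e : 𝒯.Edge) (x : Seg e.1) : mval μ e x = pval (mPoly e μ) x :=
  (pval_edgeLift (μ e) x).symm

/-- The polynomial `U - Û` on the edge `e` of the element `T`. -/
noncomputable def jump (T : 𝒯.Elem) (e : 𝒯.Edge) :
    𝒯.W k × 𝒯.V k × 𝒯.M k →ₗ[ℝ] MvPolynomial (Fin 2) ℝ :=
  uPoly T ∘ₗ LinearMap.fst ℝ _ _ - mPoly e ∘ₗ LinearMap.snd ℝ _ _ ∘ₗ LinearMap.snd ℝ _ _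

theorem jump_apply (T : 𝒯.Elem) (e : 𝒯.Edge) (X : 𝒯.W k × 𝒯.V k × 𝒯.M k) :
    jump T e X = uPoly T X.1 - mPoly e X.2.2 := rfl

/-- The numerical flux `Q · n - τ (U - Û)` as a polynomial. -/
noncomputable def fluxPoly (τ : 𝒯.Edge → ℝ) (T : 𝒯.Elem) (e : 𝒯.Edge)
    (X : 𝒯.W k × 𝒯.V k × 𝒯.M k) : MvPolynomial (Fin 2) ℝ :=
  ∑ i, outwardNormal T.1 e.1 i • qPoly T i X.2.1 - τ e • jump T e X

theorem flux_eq (τ : 𝒯.Edge → ℝ) (X : 𝒯.W k × 𝒯.V k × 𝒯.M k) (T : 𝒯.Elem) (e : 𝒯.Edge)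
    (x : Seg e.1) : flux τ X T e x = pval (fluxPoly τ T e X) x := by
  simp only [flux, normalTrace, vval_eq, uval_eq, mval_eq, fluxPoly, jump_apply]
  simp [pval, mul_comm]

theorem elemInt_eq (g : 𝒯.Elem → MvPolynomial (Fin 2) ℝ) :
    𝒯.elemInt (fun T x => pval (g T) x) = ∑ T, triInt T.1 (g T) := rfl

theorem skelInt_eq (g : 𝒯.Elem → 𝒯.Edge → MvPolynomial (Fin 2) ℝ) :
    𝒯.skelInt (fun T e x => pval (g T e) x) =
      ∑ z ∈ 𝒯.incidences, edgeInt z.2 (g z.1 z.2) := by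
  classical
  rw [sum_incidences fun T e => edgeInt e (g T e), skelInt]
  rfl

/-- The bilinear form `(Q, v)` on `V_h`. -/
noncomputable def massV : 𝒯.V k →ₗ[ℝ] 𝒯.V k →ₗ[ℝ] ℝ :=
  ∑ T, ∑ i, mulForm (triInt T.1) (qPoly T i) (qPoly T i)

theorem massV_apply (Q v : 𝒯.V k) :
    massV Q v = ∑ T, ∑ i, triInt T.1 (qPoly T i Q * qPoly T i v) := by
  simp [massV]

/-- The bilinear form `(U, ∇ · v)`. -/
noncomputable def divForm : 𝒯.W k →ₗ[ℝ] 𝒯.V k →ₗ[ℝ] ℝ :=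
  ∑ T, ∑ i, mulForm (triInt T.1) (uPoly T) ((MvPolynomial.pderiv i).toLinearMap ∘ₗ qPoly T i)

theorem divForm_apply (w : 𝒯.W k) (v : 𝒯.V k) :
    divForm w v = ∑ T, ∑ i, triInt T.1 (uPoly T w * MvPolynomial.pderiv i (qPoly T i v)) := by
  simp [divForm]

/-- The bilinear form `⟨Û, v · n⟩`. -/
noncomputable def traceForm : 𝒯.M k →ₗ[ℝ] 𝒯.V k →ₗ[ℝ] ℝ :=
  ∑ z ∈ 𝒯.incidences, ∑ i,
    outwardNormal z.1.1 z.2.1 i • mulForm (edgeInt z.2) (mPoly z.2) (qPoly z.1 i)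

theorem traceForm_apply (μ : 𝒯.M k) (v : 𝒯.V k) :
    traceForm μ v = ∑ z ∈ 𝒯.incidences, ∑ i,
      outwardNormal z.1.1 z.2.1 i * edgeInt z.2 (mPoly z.2 μ * qPoly z.1 i v) := by
  simp [traceForm]

/-- The bilinear form `(Q, ∇ w)`. -/
noncomputable def gradForm : 𝒯.V k →ₗ[ℝ] 𝒯.W k →ₗ[ℝ] ℝ :=
  ∑ T, ∑ i, mulForm (triInt T.1) (qPoly T i) ((MvPolynomial.pderiv i).toLinearMap ∘ₗ uPoly T)

theorem gradForm_apply (Q : 𝒯.V k) (w : 𝒯.W k) :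
    gradForm Q w = ∑ T, ∑ i, triInt T.1 (qPoly T i Q * MvPolynomial.pderiv i (uPoly T w)) := by
  simp [gradForm]

/-- Integration by parts on each element. -/
theorem gradForm_add_divForm (Q : 𝒯.V k) (w : 𝒯.W k) :
    gradForm Q w + divForm w Q = ∑ z ∈ 𝒯.incidences, ∑ i,
      outwardNormal z.1.1 z.2.1 i * edgeInt z.2 (uPoly z.1 w * qPoly z.1 i Q) := by
  rw [← sum_triInt_pderiv fun T i => uPoly T w * qPoly T i Q, gradForm_apply, divForm_apply,
    ← Finset.sum_add_distrib]
  refine Finset.sum_congr rfl fun T _ => ?_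
  rw [← Finset.sum_add_distrib]
  refine Finset.sum_congr rfl fun i _ => ?_
  rw [← map_add, Derivation.leibniz]
  congr 1
  simp only [smul_eq_mul]
  ring

/-- The discrete gradient equation in terms of bilinear forms. -/
theorem gradientEq_iff (X : 𝒯.W k × 𝒯.V k × 𝒯.M k) :
    GradientEq X ↔ ∀ v, massV X.2.1 v + divForm X.1 v - traceForm X.2.2 v = 0 := by
  refine forall_congr' fun v => ?_
  rw [massV_apply, divForm_apply, traceForm_apply]
  have h1 := elemInt_eq fun T : 𝒯.Elem => ∑ i, qPoly T i X.2.1 * qPoly T i v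
  have h2 := elemInt_eq fun T : 𝒯.Elem =>
    ∑ i, uPoly T X.1 * MvPolynomial.pderiv i (qPoly T i v)
  have h3 := skelInt_eq fun (T : 𝒯.Elem) (e : 𝒯.Edge) =>
    ∑ i, outwardNormal T.1 e.1 i • (mPoly e X.2.2 * qPoly T i v)
  simp only [map_sum, map_smul, smul_eq_mul] at h1 h2 h3
  rw [← h1, ← h2, ← h3]
  simp only [normalTrace, vval_eq, uval_eq, mval_eq, divergence]
  simp [pval, qPoly, add_mul, mul_comm, mul_assoc]

theorem triInt_elem_definite (T : 𝒯.Elem) {p : MvPolynomial (Fin 2) ℝ}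
    (hp : triInt T.1 (p * p) = 0) : p = 0 :=
  eq_zero_of_triInt_mul_self_eq_zero (𝒯.card_eq T.1 T.2) (𝒯.nondegenerate T.1 T.2) hp

theorem massV_self_nonneg (Q : 𝒯.V k) : 0 ≤ massV Q Q := by
  rw [massV_apply]
  exact Finset.sum_nonneg fun T _ => Finset.sum_nonneg fun i _ => triInt_mul_self_nonneg _ _

theorem eq_zero_of_massV_self {Q : 𝒯.V k} (h : massV Q Q = 0) : Q = 0 := by
  rw [massV_apply, Finset.sum_eq_zero_iff_of_nonneg
    fun T _ => Finset.sum_nonneg fun i _ => triInt_mul_self_nonneg _ _] at h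
  funext T i
  have h1 := h T (Finset.mem_univ _)
  rw [Finset.sum_eq_zero_iff_of_nonneg fun i _ => triInt_mul_self_nonneg _ _] at h1
  exact Subtype.ext (triInt_elem_definite T (h1 i (Finset.mem_univ _)))

/-- Riesz representation in `V_h` with respect to the `L²` inner product. -/
theorem exists_massV_eq (f : 𝒯.V k →ₗ[ℝ] ℝ) : ∃ v, massV v = f := by
  have hinj : Function.Injective (massV : 𝒯.V k →ₗ[ℝ] Module.Dual ℝ (𝒯.V k)) := by
    rw [injective_iff_map_eq_zero]
    intro v hv
    exact eq_zero_of_massV_self (by rw [hv, LinearMap.zero_apply])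
  exact (LinearMap.injective_iff_surjective_of_finrank_eq_finrank
    Subspace.dual_finrank_eq.symm).mp hinj f

/-- Given `U` and `Û`, the discrete gradient equation can be solved for `Q`. -/
theorem exists_gradientEq (w : 𝒯.W k) (μ : 𝒯.M k) : ∃ v : 𝒯.V k, GradientEq (w, v, μ) := by
  obtain ⟨v, hv⟩ := exists_massV_eq (traceForm μ - divForm w)
  refine ⟨v, (gradientEq_iff _).mpr fun v' => ?_⟩
  simp [hv]

/-- The pairing `⟨Q̂ · n, w⟩` of the flux with an element function. -/
noncomputable def fluxW (τ : 𝒯.Edge → ℝ) (X : 𝒯.W k × 𝒯.V k × 𝒯.M k) : 𝒯.W k →ₗ[ℝ] ℝ :=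
  ∑ z ∈ 𝒯.incidences, edgeInt z.2 ∘ₗ LinearMap.mulLeft ℝ (fluxPoly τ z.1 z.2 X) ∘ₗ uPoly z.1

theorem fluxW_apply (τ : 𝒯.Edge → ℝ) (X : 𝒯.W k × 𝒯.V k × 𝒯.M k) (w : 𝒯.W k) :
    fluxW τ X w = ∑ z ∈ 𝒯.incidences, edgeInt z.2 (fluxPoly τ z.1 z.2 X * uPoly z.1 w) := by
  simp [fluxW]

/-- The pairing `⟨Q̂ · n, μ⟩` of the flux with an edge function, over all edges. -/
noncomputable def fluxM (τ : 𝒯.Edge → ℝ) (X : 𝒯.W k × 𝒯.V k × 𝒯.M k) (μ : 𝒯.M k) : ℝ :=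
  ∑ z ∈ 𝒯.incidences, edgeInt z.2 (fluxPoly τ z.1 z.2 X * mPoly z.2 μ)

/-- The stabilisation form `⟨τ (U - Û), w - μ⟩`. -/
noncomputable def stabForm (τ : 𝒯.Edge → ℝ) :
    𝒯.W k × 𝒯.V k × 𝒯.M k →ₗ[ℝ] 𝒯.W k × 𝒯.V k × 𝒯.M k →ₗ[ℝ] ℝ :=
  ∑ z ∈ 𝒯.incidences, τ z.2 • mulForm (edgeInt z.2) (jump z.1 z.2) (jump z.1 z.2)

theorem stabForm_apply (τ : 𝒯.Edge → ℝ) (X Y : 𝒯.W k × 𝒯.V k × 𝒯.M k) :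
    stabForm τ X Y = ∑ z ∈ 𝒯.incidences,
      τ z.2 * edgeInt z.2 (jump z.1 z.2 X * jump z.1 z.2 Y) := by
  simp [stabForm]

/-- The energy identity: for test triples satisfying the discrete gradient equation, the
nonsymmetric form of the scheme equals a symmetric one. -/
theorem gradForm_sub_fluxW_add_fluxM (τ : 𝒯.Edge → ℝ) (X Y : 𝒯.W k × 𝒯.V k × 𝒯.M k)
    (hY : GradientEq Y) :
    gradForm X.2.1 Y.1 - fluxW τ X Y.1 + fluxM τ X Y.2.2 =
      massV X.2.1 Y.2.1 + stabForm τ X Y := by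
  have h1 := (gradientEq_iff Y).mp hY X.2.1
  have h2 := gradForm_add_divForm X.2.1 Y.1
  have h3 : massV Y.2.1 X.2.1 = massV X.2.1 Y.2.1 := by simp [massV_apply, mul_comm]
  have h4 : fluxW τ X Y.1 - fluxM τ X Y.2.2 =
      (∑ z ∈ 𝒯.incidences, ∑ i,
        outwardNormal z.1.1 z.2.1 i * edgeInt z.2 (uPoly z.1 Y.1 * qPoly z.1 i X.2.1)) -
      traceForm Y.2.2 X.2.1 - stabForm τ X Y := by
    rw [fluxW_apply, fluxM, traceForm_apply, stabForm_apply, ← Finset.sum_sub_distrib,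
      ← Finset.sum_sub_distrib, ← Finset.sum_sub_distrib]
    refine Finset.sum_congr rfl fun z _ => ?_
    rw [jump_apply _ _ Y, fluxPoly]
    generalize uPoly z.1 Y.1 = u
    generalize mPoly z.2 Y.2.2 = m
    simp only [Fin.sum_univ_two, sub_mul, add_mul, mul_sub, smul_mul_assoc, map_sub, map_add,
      map_smul, smul_eq_mul, mul_comm u, mul_comm m]
    ring
  linarith

end Triangulation

/-! ### The nonlinear term -/

/-- The difference quotient of `F` is a polynomial, also on the diagonal. -/
theorem scrF_eq (a b : ℝ) :
    scrF a b = (a ^ 3 + a ^ 2 * b + a * b ^ 2) / 4 - a / 2 + (b ^ 3 / 4 - b / 2) := by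
  unfold scrF
  split_ifs with h
  · rw [div_eq_iff (sub_ne_zero.mpr h)]
    unfold F
    ring
  · obtain rfl : a = b := not_not.mp h
    have hF : HasDerivAt F (a ^ 3 - a) a := by
      have h1 := ((((hasDerivAt_id a).pow 2).const_sub 1).pow 2).const_mul (1 / 4 : ℝ)
      refine HasDerivAt.congr_deriv (f := F) h1 ?_
      simp
      ring
    rw [hF.deriv]
    ring

/-- The monotone part `(p³ + p² z + p z²) / 4` of `ℱ(p, z)`. -/
noncomputable def monoPart (p z : MvPolynomial (Fin 2) ℝ) : MvPolynomial (Fin 2) ℝ :=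
  (1 / 4 : ℝ) • (p ^ 3 + p ^ 2 * z + p * z ^ 2)

/-- A nonnegative potential whose derivative in `p` is `monoPart p z`. -/
noncomputable def potential (p z : MvPolynomial (Fin 2) ℝ) : MvPolynomial (Fin 2) ℝ :=
  (1 / 16 : ℝ) • p ^ 4 + (1 / 12 : ℝ) • (p ^ 3 * z) + (1 / 8 : ℝ) • (p ^ 2 * z ^ 2)

theorem pval_potential_nonneg (p z : MvPolynomial (Fin 2) ℝ) (x : Plane) :
    0 ≤ pval (potential p z) x := by
  have h : pval (potential p z) x =
      pval p x ^ 2 * ((pval p x / 4 + pval z x / 6) ^ 2 + 7 / 72 * pval z x ^ 2) := by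
    simp [pval, potential, MvPolynomial.smul_eval]
    ring
  rw [h]
  positivity

theorem pval_monoPart_sub_mul_nonneg (p q z : MvPolynomial (Fin 2) ℝ) (x : Plane) :
    0 ≤ pval ((monoPart p z - monoPart q z) * (p - q)) x := by
  have h : pval ((monoPart p z - monoPart q z) * (p - q)) x =
      (pval p x - pval q x) ^ 2 * ((pval p x + pval q x + pval z x) ^ 2 +
        pval p x ^ 2 + pval q x ^ 2 + pval z x ^ 2) / 8 := by
    simp [pval, monoPart, MvPolynomial.smul_eval]
    ring
  rw [h]
  positivity

theorem hasDerivAt_triInt_potential (T : Finset Plane) (p q z : MvPolynomial (Fin 2) ℝ) :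
    HasDerivAt (fun t : ℝ => triInt T (potential (p + t • q) z)) (triInt T (monoPart p z * q)) 0 := by
  have h : (fun t : ℝ => triInt T (potential (p + t • q) z)) = fun t =>
      triInt T (potential p z) + t * triInt T (monoPart p z * q) +
        t ^ 2 * triInt T ((3 / 8 : ℝ) • (p ^ 2 * q ^ 2) + (1 / 4 : ℝ) • (p * q ^ 2 * z) +
          (1 / 8 : ℝ) • (q ^ 2 * z ^ 2)) +
        t ^ 3 * triInt T ((1 / 4 : ℝ) • (p * q ^ 3) + (1 / 12 : ℝ) • (q ^ 3 * z)) +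
        t ^ 4 * triInt T ((1 / 16 : ℝ) • q ^ 4) := by
    funext t
    simp only [← smul_eq_mul (α := ℝ), ← map_smul, ← map_add]
    congr 1
    simp only [potential, monoPart, add_mul, smul_add, smul_mul_assoc, smul_smul]
    rw [show p + t • q = p + MvPolynomial.C t * q by rw [MvPolynomial.smul_eq_C_mul]]
    simp only [MvPolynomial.smul_eq_C_mul]
    simp only [map_mul, map_pow]
    -- The relations between the numerical coefficients, after which they can be treated as
    -- variables.
    have e1 : (MvPolynomial.C (1 / 4 : ℝ) : MvPolynomial (Fin 2) ℝ) =
        4 * MvPolynomial.C (1 / 16 : ℝ) := by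
      rw [← map_ofNat MvPolynomial.C 4, ← map_mul]
      norm_num
    have e2 : (MvPolynomial.C (1 / 4 : ℝ) : MvPolynomial (Fin 2) ℝ) =
        3 * MvPolynomial.C (1 / 12 : ℝ) := by
      rw [← map_ofNat MvPolynomial.C 3, ← map_mul]
      norm_num
    have e3 : (MvPolynomial.C (1 / 4 : ℝ) : MvPolynomial (Fin 2) ℝ) =
        2 * MvPolynomial.C (1 / 8 : ℝ) := by
      rw [← map_ofNat MvPolynomial.C 2, ← map_mul]
      norm_num
    have e4 : (MvPolynomial.C (3 / 8 : ℝ) : MvPolynomial (Fin 2) ℝ) =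
        6 * MvPolynomial.C (1 / 16 : ℝ) := by
      rw [← map_ofNat MvPolynomial.C 6, ← map_mul]
      norm_num
    generalize MvPolynomial.C t = s
    generalize MvPolynomial.C (1 / 4 : ℝ) = c4 at *
    generalize MvPolynomial.C (1 / 8 : ℝ) = c8 at *
    generalize MvPolynomial.C (1 / 12 : ℝ) = c12 at *
    generalize MvPolynomial.C (1 / 16 : ℝ) = c16 at *
    rw [e4]
    linear_combination -(s * p ^ 3 * q + s ^ 3 * p * q ^ 3) * e1
      - (s * p ^ 2 * q * z + s ^ 2 * p * q ^ 2 * z) * e2 - s * p * q * z ^ 2 * e3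
  rw [h]
  generalize triInt T (potential p z) = g₀
  generalize triInt T (monoPart p z * q) = g₁
  generalize triInt T ((3 / 8 : ℝ) • (p ^ 2 * q ^ 2) + (1 / 4 : ℝ) • (p * q ^ 2 * z) +
    (1 / 8 : ℝ) • (q ^ 2 * z ^ 2)) = g₂
  generalize triInt T ((1 / 4 : ℝ) • (p * q ^ 3) + (1 / 12 : ℝ) • (q ^ 3 * z)) = g₃
  generalize triInt T ((1 / 16 : ℝ) • q ^ 4) = g₄
  have h1 := (((((hasDerivAt_id (0 : ℝ)).mul_const g₁).const_add g₀).add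
    ((hasDerivAt_pow 2 (0 : ℝ)).mul_const g₂)).add
    ((hasDerivAt_pow 3 (0 : ℝ)).mul_const g₃)).add ((hasDerivAt_pow 4 (0 : ℝ)).mul_const g₄)
  exact h1.congr_deriv (by simp)

/-- The value of a polynomial is jointly continuous in finitely many coefficients and the point. -/
theorem continuous_pval_linear {d : ℕ} (A : (Fin d → ℝ) →ₗ[ℝ] MvPolynomial (Fin 2) ℝ) :
    Continuous fun z : (Fin d → ℝ) × Plane => pval (A z.1) z.2 := by
  have h : (fun z : (Fin d → ℝ) × Plane => pval (A z.1) z.2) = fun z =>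
      ∑ j, z.1 j * pval (A fun i => if j = i then 1 else 0) z.2 := by
    funext z
    rw [LinearMap.pi_apply_eq_sum_univ A z.1]
    simp [pval, MvPolynomial.smul_eval]
  rw [h]
  have := continuous_pval
  fun_prop

theorem continuous_triInt_potential (T : Finset Plane) {d : ℕ}
    (A : (Fin d → ℝ) →ₗ[ℝ] MvPolynomial (Fin 2) ℝ) (z : MvPolynomial (Fin 2) ℝ) :
    Continuous fun y => triInt T (potential (A y) z) := by
  refine continuous_parametric_integral_of_continuous (μ := volume)
    (f := fun y x => pval (potential (A y) z) x) ?_ (T.finite_toSet.isCompact_convexHull ℝ)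
  have h : (Function.uncurry fun y x => pval (potential (A y) z) x) =
      fun v : (Fin d → ℝ) × Plane => 1 / 16 * pval (A v.1) v.2 ^ 4 +
        1 / 12 * (pval (A v.1) v.2 ^ 3 * pval z v.2) +
        1 / 8 * (pval (A v.1) v.2 ^ 2 * pval z v.2 ^ 2) := by
    funext v
    simp [pval, potential, MvPolynomial.smul_eval, Function.uncurry]
  rw [h]
  have h1 := continuous_pval_linear A
  have h2 := continuous_pval z
  fun_prop

namespace Triangulation

variable {Ω : Set Plane} {𝒯 : Triangulation Ω} {k : ℕ}

/-! ### The variational form of one time step -/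

/-- The bilinear form `(U, w)` on `W_h`. -/
noncomputable def massW : 𝒯.W k →ₗ[ℝ] 𝒯.W k →ₗ[ℝ] ℝ :=
  ∑ T, mulForm (triInt T.1) (uPoly T) (uPoly T)

theorem massW_apply (U w : 𝒯.W k) : massW U w = ∑ T, triInt T.1 (uPoly T U * uPoly T w) := by
  simp [massW]

theorem massW_self_nonneg (U : 𝒯.W k) : 0 ≤ massW U U := by
  rw [massW_apply]
  exact Finset.sum_nonneg fun T _ => triInt_mul_self_nonneg _ _

theorem eq_zero_of_massW_self {U : 𝒯.W k} (h : massW U U = 0) : U = 0 := by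
  rw [massW_apply, Finset.sum_eq_zero_iff_of_nonneg fun T _ => triInt_mul_self_nonneg _ _] at h
  funext T
  exact Subtype.ext (triInt_elem_definite T (h T (Finset.mem_univ _)))

theorem stabForm_self_nonneg {τ : 𝒯.Edge → ℝ} (hτ : ∀ e, 0 < τ e)
    (X : 𝒯.W k × 𝒯.V k × 𝒯.M k) : 0 ≤ stabForm τ X X := by
  rw [stabForm_apply]
  exact Finset.sum_nonneg fun z _ =>
    mul_nonneg (hτ z.2).le (segInt_mul_self_nonneg _ (card_edge z.2) _)

theorem edgeInt_mul_self_nonneg (e : 𝒯.Edge) (p : MvPolynomial (Fin 2) ℝ) :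
    0 ≤ edgeInt e (p * p) :=
  segInt_mul_self_nonneg _ (card_edge e) p

theorem eq_zero_of_edgeInt_mPoly {μ : 𝒯.M k} {e : 𝒯.Edge}
    (h : edgeInt e (mPoly e μ * mPoly e μ) = 0) : μ e = 0 := by
  refine Subtype.ext (funext fun x => ?_)
  rw [← pval_edgeLift]
  exact pval_eq_zero_of_segInt_mul_self_eq_zero (card_edge e) h x

/-- If `U = 0` and the stabilisation vanishes, then the trace `Û` vanishes on every edge, because
every edge is a side of an element. -/
theorem eq_zero_of_stabForm_self {τ : 𝒯.Edge → ℝ} (hτ : ∀ e, 0 < τ e)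
    {X : 𝒯.W k × 𝒯.V k × 𝒯.M k} (hX : X.1 = 0) (h : stabForm τ X X = 0) : X.2.2 = 0 := by
  rw [stabForm_apply, Finset.sum_eq_zero_iff_of_nonneg fun z _ =>
    mul_nonneg (hτ z.2).le (segInt_mul_self_nonneg _ (card_edge z.2) _)] at h
  funext e
  obtain ⟨T, hT⟩ := exists_elem_of_edge e
  have h1 := h (T, e) (mem_incidences.mpr hT)
  rw [mul_eq_zero_iff_left (hτ e).ne', jump_apply, hX, map_zero, zero_sub, neg_mul_neg] at h1
  exact eq_zero_of_edgeInt_mPoly h1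

theorem boundaryEq_iff (X : 𝒯.W k × 𝒯.V k × 𝒯.M k) :
    BoundaryEq X ↔ ∀ e, 𝒯.IsBoundaryEdge e → X.2.2 e = 0 := by
  classical
  have hint : ∀ μ : 𝒯.M k, 𝒯.boundaryInt (fun e x => mval X.2.2 e x * mval μ e x) =
      ∑ e : 𝒯.Edge with 𝒯.IsBoundaryEdge e, edgeInt e (mPoly e X.2.2 * mPoly e μ) := by
    intro μ
    rw [boundaryInt]
    simp only [mval_eq]
    refine Finset.sum_congr (by congr) fun e _ => ?_
    rw [edgeInt, segInt_apply]
    simp [pval]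
  constructor
  · intro h e he
    have h1 := h X.2.2
    rw [hint, Finset.sum_eq_zero_iff_of_nonneg
      fun e _ => edgeInt_mul_self_nonneg e _] at h1
    exact eq_zero_of_edgeInt_mPoly (h1 e (by simpa using he))
  · intro h μ
    rw [hint]
    refine Finset.sum_eq_zero fun e he => ?_
    have h0 : mPoly e X.2.2 = 0 := by
      simp [mPoly, h e (by simpa using he)]
    rw [h0, zero_mul, map_zero]

/-- Test functions for the flux condition may be taken to vanish on the boundary edges. -/
theorem fluxEq_iff (τ : 𝒯.Edge → ℝ) (X : 𝒯.W k × 𝒯.V k × 𝒯.M k) :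
    FluxEq τ X ↔ ∀ μ : 𝒯.M k, (∀ e, 𝒯.IsBoundaryEdge e → μ e = 0) → fluxM τ X μ = 0 := by
  classical
  have hint : ∀ μ : 𝒯.M k, 𝒯.interiorInt (fun T e x => flux τ X T e x * mval μ e x) =
      ∑ e : 𝒯.Edge with ¬ 𝒯.IsBoundaryEdge e, ∑ T : 𝒯.Elem with e.1 ⊆ T.1,
        edgeInt e (fluxPoly τ T e X * mPoly e μ) := by
    intro μ
    rw [interiorInt]
    simp only [mval_eq, flux_eq]
    refine Finset.sum_congr (by congr) fun e _ => Finset.sum_congr (by congr) fun T _ => ?_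
    rw [edgeInt, segInt_apply]
    simp [pval]
  have hflux : ∀ μ : 𝒯.M k, (∀ e, 𝒯.IsBoundaryEdge e → μ e = 0) →
      fluxM τ X μ = 𝒯.interiorInt (fun T e x => flux τ X T e x * mval μ e x) := by
    intro μ hμ
    rw [hint, fluxM, sum_incidences_right fun T e => edgeInt e (fluxPoly τ T e X * mPoly e μ)]
    symm
    refine Finset.sum_subset_zero_on_sdiff (Finset.subset_univ _) (fun e he => ?_)
      (fun e _ => Finset.sum_congr (by congr) fun _ _ => rfl)
    have h0 : mPoly e μ = 0 := by
      simp [mPoly, hμ e (by simpa using he)]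
    simp [h0]
  constructor
  · intro h μ hμ
    rw [hflux μ hμ]
    exact h μ
  · intro h μ
    let μ' : 𝒯.M k := fun e => if 𝒯.IsBoundaryEdge e then 0 else μ e
    have hμ' : ∀ e, 𝒯.IsBoundaryEdge e → μ' e = 0 := fun e he => by simp [μ', he]
    have h1 := h μ' hμ'
    rw [hflux μ' hμ', hint] at h1
    rw [hint, ← h1]
    refine Finset.sum_congr rfl fun e he => ?_
    have h0 : mPoly e μ = mPoly e μ' := by
      have : ¬ 𝒯.IsBoundaryEdge e := by simpa using he
      simp [mPoly, μ', this]
    rw [h0]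

/-- The triples satisfying the discrete gradient equation and the boundary condition. -/
def trialSpace (𝒯 : Triangulation Ω) (k : ℕ) : Submodule ℝ (𝒯.W k × 𝒯.V k × 𝒯.M k) where
  carrier := {X | GradientEq X ∧ ∀ e, 𝒯.IsBoundaryEdge e → X.2.2 e = 0}
  zero_mem' := ⟨(gradientEq_iff _).mpr (by simp), by simp⟩
  add_mem' := by
    rintro X Y ⟨hX, hX'⟩ ⟨hY, hY'⟩
    refine ⟨(gradientEq_iff _).mpr fun v => ?_, fun e he => by simp [hX' e he, hY' e he]⟩
    have h1 := (gradientEq_iff _).mp hX v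
    have h2 := (gradientEq_iff _).mp hY v
    simp only [Prod.fst_add, Prod.snd_add, map_add, LinearMap.add_apply]
    linarith
  smul_mem' := by
    rintro r X ⟨hX, hX'⟩
    refine ⟨(gradientEq_iff _).mpr fun v => ?_, fun e he => by simp [hX' e he]⟩
    have h1 := (gradientEq_iff _).mp hX v
    simp only [Prod.smul_fst, Prod.smul_snd, map_smul, LinearMap.smul_apply, smul_eq_mul]
    linear_combination r * h1

theorem mem_trialSpace {X : 𝒯.W k × 𝒯.V k × 𝒯.M k} :
    X ∈ trialSpace 𝒯 k ↔ GradientEq X ∧ ∀ e, 𝒯.IsBoundaryEdge e → X.2.2 e = 0 := Iff.rfl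

/-- The symmetric bilinear form
`(c - 1/2) (U, w) + (1/2) (Q, v) + (1/2) ⟨τ (U - Û), w - μ⟩`. -/
noncomputable def energyForm (c : ℝ) (τ : 𝒯.Edge → ℝ) :
    𝒯.W k × 𝒯.V k × 𝒯.M k →ₗ[ℝ] 𝒯.W k × 𝒯.V k × 𝒯.M k →ₗ[ℝ] ℝ :=
  (c - 1 / 2) • massW.compl₁₂ (LinearMap.fst ℝ _ _) (LinearMap.fst ℝ _ _) +
    (1 / 2 : ℝ) • (massV.compl₁₂ (LinearMap.fst ℝ _ _ ∘ₗ LinearMap.snd ℝ _ _)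
      (LinearMap.fst ℝ _ _ ∘ₗ LinearMap.snd ℝ _ _) + stabForm τ)

theorem energyForm_apply (c : ℝ) (τ : 𝒯.Edge → ℝ) (X Y : 𝒯.W k × 𝒯.V k × 𝒯.M k) :
    energyForm c τ X Y =
      (c - 1 / 2) * massW X.1 Y.1 + 1 / 2 * (massV X.2.1 Y.2.1 + stabForm τ X Y) := rfl

theorem energyForm_symm (c : ℝ) (τ : 𝒯.Edge → ℝ) (X Y : 𝒯.W k × 𝒯.V k × 𝒯.M k) :
    energyForm c τ X Y = energyForm c τ Y X := by
  simp only [energyForm_apply, massW_apply, massV_apply, stabForm_apply, mul_comm (uPoly _ X.1),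
    mul_comm (qPoly _ _ X.2.1), mul_comm (jump _ _ X)]

theorem energyForm_pos {c : ℝ} (hc : 1 / 2 < c) {τ : 𝒯.Edge → ℝ} (hτ : ∀ e, 0 < τ e)
    {X : 𝒯.W k × 𝒯.V k × 𝒯.M k} (hX : X ≠ 0) : 0 < energyForm c τ X X := by
  by_contra! h
  apply hX
  rw [energyForm_apply] at h
  have h1 := massW_self_nonneg X.1
  have h2 := massV_self_nonneg X.2.1
  have h3 := stabForm_self_nonneg hτ X
  have h4 : 0 ≤ (c - 1 / 2) * massW X.1 X.1 := mul_nonneg (by linarith) h1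
  have hU : X.1 = 0 := by
    refine eq_zero_of_massW_self ?_
    have : (c - 1 / 2) * massW X.1 X.1 = 0 := by linarith
    exact (mul_eq_zero_iff_left (by linarith)).mp this
  have hQ : X.2.1 = 0 := eq_zero_of_massV_self (by linarith)
  have hM : X.2.2 = 0 := eq_zero_of_stabForm_self hτ hU (by linarith)
  exact Prod.ext hU (Prod.ext hQ hM)

/-- The flux condition and the equation of motion, whose nonlinear part is `R`, amount to one
variational equation on the trial space. -/
theorem forall_motion_and_fluxEq_iff (τ : 𝒯.Edge → ℝ) (R : 𝒯.W k → ℝ) (hR : R 0 = 0)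
    (Y : 𝒯.W k × 𝒯.V k × 𝒯.M k) :
    ((∀ w, R w + 1 / 2 * (gradForm Y.2.1 w - fluxW τ Y w) = 0) ∧ FluxEq τ Y) ↔
      ∀ Φ ∈ trialSpace 𝒯 k, R Φ.1 + 1 / 2 * (massV Y.2.1 Φ.2.1 + stabForm τ Y Φ) = 0 := by
  rw [fluxEq_iff]
  constructor
  · rintro ⟨h1, h2⟩ Φ ⟨hΦ, hΦ'⟩
    rw [← gradForm_sub_fluxW_add_fluxM τ Y Φ hΦ, h2 _ hΦ', add_zero]
    exact h1 Φ.1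
  · intro h
    constructor
    -- Testing with `μ = 0` gives the equation of motion, with `w = 0` the flux condition.
    · intro w
      obtain ⟨v, hv⟩ := exists_gradientEq w (0 : 𝒯.M k)
      have h1 := h _ ⟨hv, fun _ _ => rfl⟩
      rw [← gradForm_sub_fluxW_add_fluxM τ Y _ hv] at h1
      simpa [fluxM] using h1
    · intro μ hμ
      obtain ⟨v, hv⟩ := exists_gradientEq (0 : 𝒯.W k) μ
      have h1 := h _ ⟨hv, hμ⟩
      rw [← gradForm_sub_fluxW_add_fluxM τ Y _ hv] at h1
      simpa [hR] using h1

/-- The part of `(ℱ(U, z), w)` that does not depend on `U`. -/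
noncomputable def sourceForm (z : 𝒯.W k) : 𝒯.W k →ₗ[ℝ] ℝ :=
  ∑ T, triInt T.1 ∘ₗ
    LinearMap.mulLeft ℝ ((1 / 4 : ℝ) • uPoly T z ^ 3 - (1 / 2 : ℝ) • uPoly T z) ∘ₗ uPoly T

/-- The monotone part of `(ℱ(U, z), w)`. -/
noncomputable def monoForm (z U w : 𝒯.W k) : ℝ :=
  ∑ T, triInt T.1 (monoPart (uPoly T U) (uPoly T z) * uPoly T w)

theorem elemInt_scrF (z U w : 𝒯.W k) :
    𝒯.elemInt (fun T x => scrF (uval U T x) (uval z T x) * uval w T x) =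
      monoForm z U w - 1 / 2 * massW U w + sourceForm z w := by
  have h := elemInt_eq fun T : 𝒯.Elem => (monoPart (uPoly T U) (uPoly T z) -
    (1 / 2 : ℝ) • uPoly T U + ((1 / 4 : ℝ) • uPoly T z ^ 3 - (1 / 2 : ℝ) • uPoly T z)) * uPoly T w
  have h1 : monoForm z U w - 1 / 2 * massW U w + sourceForm z w =
      ∑ T : 𝒯.Elem, triInt T.1 ((monoPart (uPoly T U) (uPoly T z) - (1 / 2 : ℝ) • uPoly T U +
        ((1 / 4 : ℝ) • uPoly T z ^ 3 - (1 / 2 : ℝ) • uPoly T z)) * uPoly T w) := by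
    rw [monoForm, massW_apply, sourceForm, LinearMap.sum_apply, Finset.mul_sum,
      ← Finset.sum_sub_distrib, ← Finset.sum_add_distrib]
    refine Finset.sum_congr rfl fun T _ => ?_
    rw [add_mul, sub_mul, map_add, map_sub, smul_mul_assoc, map_smul]
    rfl
  rw [h1, ← h]
  congr 1
  funext T x
  rw [scrF_eq, uval_eq, uval_eq, uval_eq]
  simp [pval, monoPart, MvPolynomial.smul_eval, -mul_eq_mul_right_iff]
  ring

/-- Existence and uniqueness for one implicit step with mass coefficient `c > 1/2`. The bound on
`c` compensates the concave part `-U²/4` of the potential of `ℱ(U, z)`. -/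
theorem existsUnique_step {c : ℝ} (hc : 1 / 2 < c) {τ : 𝒯.Edge → ℝ} (hτ : ∀ e, 0 < τ e)
    (z : 𝒯.W k) (ℓ : 𝒯.W k →ₗ[ℝ] ℝ) :
    ∃! Y : 𝒯.W k × 𝒯.V k × 𝒯.M k,
      (∀ w, c * massW Y.1 w + 1 / 2 * (gradForm Y.2.1 w - fluxW τ Y w) +
        𝒯.elemInt (fun T x => scrF (uval Y.1 T x) (uval z T x) * uval w T x) = ℓ w) ∧
      GradientEq Y ∧ FluxEq τ Y ∧ BoundaryEq Y := by
  have key := existsUnique_variational (trialSpace 𝒯 k) (energyForm c τ)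
    (energyForm_symm c τ) (fun X hX => energyForm_pos hc hτ hX)
    (fun X => ∑ T, triInt T.1 (potential (uPoly T X.1) (uPoly T z)))
    (fun X => Finset.sum_nonneg fun T _ => triInt_nonneg _ (pval_potential_nonneg _ _))
    (fun d φ => continuous_finsetSum _ fun T _ =>
      continuous_triInt_potential T.1 (uPoly T ∘ₗ LinearMap.fst ℝ _ _ ∘ₗ φ) (uPoly T z))
    (fun X Y => monoForm z X.1 Y.1)
    (fun X Y => by
      refine HasDerivAt.fun_sum fun T _ => ?_
      simpa using hasDerivAt_triInt_potential T.1 (uPoly T X.1) (uPoly T Y.1) (uPoly T z))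
    (fun X Y => by
      simp only [monoForm, ← Finset.sum_sub_distrib, ← map_sub, ← sub_mul]
      exact Finset.sum_nonneg fun T _ =>
        triInt_nonneg _ (by simpa using pval_monoPart_sub_mul_nonneg _ _ _))
    ((ℓ - sourceForm z) ∘ₗ LinearMap.fst ℝ _ _)
  refine (existsUnique_congr fun Y => ?_).mpr key
  have hequiv := forall_motion_and_fluxEq_iff τ
    (fun w => (c - 1 / 2) * massW Y.1 w + monoForm z Y.1 w - (ℓ - sourceForm z) w)
    (by simp [monoForm]) Y
  rw [boundaryEq_iff, mem_trialSpace]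
  constructor
  · rintro ⟨h1, h2, h3, h4⟩
    refine ⟨⟨h2, h4⟩, fun Φ hΦ => ?_⟩
    have h5 := hequiv.mp ⟨fun w => ?_, h3⟩ Φ hΦ
    · rw [energyForm_apply]
      simp only [LinearMap.comp_apply, LinearMap.fst_apply]
      linarith
    · have := h1 w
      rw [elemInt_scrF] at this
      simp only [LinearMap.sub_apply]
      linarith
  · rintro ⟨⟨h2, h4⟩, h⟩
    obtain ⟨h1, h3⟩ := hequiv.mpr fun Φ hΦ => by
      have := h Φ hΦ
      rw [energyForm_apply] at this
      simp only [LinearMap.comp_apply, LinearMap.fst_apply] at this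
      linarith
    refine ⟨fun w => ?_, h2, h3, h4⟩
    have := h1 w
    rw [elemInt_scrF]
    simp only [LinearMap.sub_apply] at this
    linarith

/-! ### The two kinds of time step -/

/-- The averaged gradient term of the scheme splits into its implicit and explicit halves. -/
theorem elemInt_average_grad (Q Q' : 𝒯.V k) (w : 𝒯.W k) :
    𝒯.elemInt (fun T x => ∑ i, (1 / 2) * (vval Q T i x + vval Q' T i x) * grad w T i x) =
      1 / 2 * (gradForm Q w + gradForm Q' w) := by
  have h := elemInt_eq fun T : 𝒯.Elem => ∑ i, (1 / 2 : ℝ) •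
    (qPoly T i (Q + Q') * MvPolynomial.pderiv i (uPoly T w))
  have h1 : 1 / 2 * (gradForm Q w + gradForm Q' w) = ∑ T : 𝒯.Elem, triInt T.1
      (∑ i, (1 / 2 : ℝ) • (qPoly T i (Q + Q') * MvPolynomial.pderiv i (uPoly T w))) := by
    rw [← LinearMap.add_apply, ← map_add, gradForm_apply, Finset.mul_sum]
    refine Finset.sum_congr rfl fun T _ => ?_
    rw [map_sum, Finset.mul_sum]
    simp only [map_smul, smul_eq_mul]
  rw [h1, ← h]
  congr 1
  funext T x
  rw [pval, map_sum]
  refine Finset.sum_congr rfl fun i _ => ?_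
  rw [map_add, MvPolynomial.smul_eval, map_mul, map_add, mul_assoc]
  rfl

/-- The averaged flux term of the scheme splits into its implicit and explicit halves. -/
theorem skelInt_average_flux (τ : 𝒯.Edge → ℝ) (X Y : 𝒯.W k × 𝒯.V k × 𝒯.M k) (w : 𝒯.W k) :
    𝒯.skelInt (fun T e x => (1 / 2) * (flux τ X T e x + flux τ Y T e x) * uval w T x) =
      1 / 2 * (fluxW τ X w + fluxW τ Y w) := by
  have h := skelInt_eq fun (T : 𝒯.Elem) (e : 𝒯.Edge) =>
    (1 / 2 : ℝ) • ((fluxPoly τ T e X + fluxPoly τ T e Y) * uPoly T w)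
  have h1 : 1 / 2 * (fluxW τ X w + fluxW τ Y w) = ∑ z ∈ 𝒯.incidences, edgeInt z.2
      ((1 / 2 : ℝ) • ((fluxPoly τ z.1 z.2 X + fluxPoly τ z.1 z.2 Y) * uPoly z.1 w)) := by
    rw [fluxW_apply, fluxW_apply, ← Finset.sum_add_distrib, Finset.mul_sum]
    simp only [map_smul, smul_eq_mul, add_mul, map_add]
  rw [h1, ← h]
  congr 1
  funext T e x
  rw [flux_eq, flux_eq, uval_eq]
  simp [pval, MvPolynomial.smul_eval, mul_assoc]

theorem elemInt_uval_mul (U w : 𝒯.W k) :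
    𝒯.elemInt (fun T x => uval U T x * uval w T x) = massW U w := by
  rw [massW_apply, ← elemInt_eq]
  simp [pval, uval_eq]

/-- A square integrable function on a convex open set is integrable over the elements of a
triangulation of its closure, since the frontier is a null set. -/
theorem integrableOn_elem (hΩ : IsConvexPolygonalDomain Ω) {u₁ : Plane → ℝ}
    (hu₁ : MemLp u₁ 2 (volume.restrict Ω)) (T : 𝒯.Elem) :
    IntegrableOn u₁ (convexHull ℝ (T.1 : Set Plane)) := by
  have hsub : convexHull ℝ (T.1 : Set Plane) ⊆ closure Ω := by
    rw [← 𝒯.cover]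
    exact Set.subset_biUnion_of_mem (u := fun T : Finset Plane => convexHull ℝ (T : Set Plane)) T.2
  have hcl : volume.restrict (closure Ω) = volume.restrict Ω :=
    Measure.restrict_congr_set
      (closure_ae_eq_of_null_frontier (hΩ.2.1.addHaar_frontier volume))
  rw [← hcl] at hu₁
  have hfin : IsFiniteMeasure (volume.restrict (convexHull ℝ (T.1 : Set Plane))) :=
    isFiniteMeasure_restrict.mpr
      (T.1.finite_toSet.isCompact_convexHull ℝ).measure_lt_top.ne
  exact (hu₁.mono_measure (Measure.restrict_mono hsub le_rfl)).integrable one_le_two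

/-- `w ↦ (u₁, w)` is a linear functional on `W_h`. Additivity needs integrability of `u₁` on the
elements. -/
theorem exists_linear_elemInt_mul (k : ℕ) (hΩ : IsConvexPolygonalDomain Ω) {u₁ : Plane → ℝ}
    (hu₁ : MemLp u₁ 2 (volume.restrict Ω)) :
    ∃ f : 𝒯.W k →ₗ[ℝ] ℝ, ∀ w, f w = 𝒯.elemInt (fun T x => u₁ x * uval w T x) := by
  have hint : ∀ (T : 𝒯.Elem) (p : MvPolynomial (Fin 2) ℝ),
      IntegrableOn (fun x => u₁ x * pval p x) (convexHull ℝ (T.1 : Set Plane)) := fun T p =>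
    (integrableOn_elem hΩ hu₁ T).mul_continuousOn (continuous_pval p).continuousOn
      (T.1.finite_toSet.isCompact_convexHull ℝ)
  refine ⟨IsLinearMap.mk' (fun w => 𝒯.elemInt (fun T x => u₁ x * uval w T x)) ⟨?_, ?_⟩,
    fun w => rfl⟩
  · intro w w'
    simp only [elemInt, ← Finset.sum_add_distrib]
    refine Finset.sum_congr rfl fun T _ => ?_
    simp only [uval_eq]
    rw [← integral_add (hint T (uPoly T w)) (hint T (uPoly T w'))]
    simp only [map_add, pval, mul_add]
  · intro r w
    simp only [elemInt, smul_eq_mul, Finset.mul_sum]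
    refine Finset.sum_congr rfl fun T _ => ?_
    rw [← integral_const_mul]
    simp only [uval_eq, map_smul, pval, MvPolynomial.smul_eval, mul_left_comm]

/-- The first step has mass coefficient `2 / Δt² ≥ 2`. -/
theorem existsUnique_firstStep (hΩ : IsConvexPolygonalDomain Ω) {τ : 𝒯.Edge → ℝ}
    (hτ : ∀ e, 0 < τ e) {u₁ : Plane → ℝ} (hu₁ : MemLp u₁ 2 (volume.restrict Ω))
    {Δt : ℝ} (hpos : 0 < Δt) (hle : Δt ≤ 1) (X : 𝒯.W k × 𝒯.V k × 𝒯.M k) :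
    ∃! Y : 𝒯.W k × 𝒯.V k × 𝒯.M k,
      FirstStepEq τ Δt u₁ X Y ∧ GradientEq Y ∧ FluxEq τ Y ∧ BoundaryEq Y := by
  have hc : 1 / 2 < 2 / Δt ^ 2 := by
    rw [lt_div_iff₀ (by positivity)]
    nlinarith
  obtain ⟨f, hf⟩ := exists_linear_elemInt_mul (𝒯 := 𝒯) k hΩ hu₁
  refine (existsUnique_congr fun Y => and_congr_left fun _ => forall_congr' fun w => ?_).mpr
    (existsUnique_step hc hτ X.1 ((2 / Δt ^ 2) • massW X.1 -
      (1 / 2 : ℝ) • (gradForm X.2.1 - fluxW τ X) + (2 / Δt) • f))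
  have h1 : 𝒯.elemInt (fun T x => (uval Y.1 T x - uval X.1 T x) / Δt * uval w T x) =
      1 / Δt * (massW Y.1 w - massW X.1 w) := by
    rw [← LinearMap.sub_apply, ← map_sub, ← smul_eq_mul, ← LinearMap.smul_apply, ← map_smul,
      ← elemInt_uval_mul]
    congr 1
    funext T x
    simp only [uval_eq, map_smul, map_sub, pval, MvPolynomial.smul_eval]
    ring
  rw [h1, elemInt_average_grad, skelInt_average_flux, ← hf]
  simp only [LinearMap.add_apply, LinearMap.sub_apply, LinearMap.smul_apply, smul_eq_mul]
  have h2 : 2 / Δt * (1 / Δt * (massW Y.1 w - massW X.1 w)) =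
      2 / Δt ^ 2 * massW Y.1 w - 2 / Δt ^ 2 * massW X.1 w := by
    field_simp
  rw [h2]
  constructor <;> intro h <;> linarith

/-- A later step has mass coefficient `1 / Δt² ≥ 1`; the nonlinearity is linked to level `n - 1`. -/
theorem existsUnique_laterStep {τ : 𝒯.Edge → ℝ} (hτ : ∀ e, 0 < τ e)
    {Δt : ℝ} (hpos : 0 < Δt) (hle : Δt ≤ 1) (Z X : 𝒯.W k × 𝒯.V k × 𝒯.M k) :
    ∃! Y : 𝒯.W k × 𝒯.V k × 𝒯.M k,
      LaterStepEq τ Δt Z X Y ∧ GradientEq Y ∧ FluxEq τ Y ∧ BoundaryEq Y := by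
  have hc : 1 / 2 < 1 / Δt ^ 2 := by
    rw [lt_div_iff₀ (by positivity)]
    nlinarith
  refine (existsUnique_congr fun Y => and_congr_left fun _ => forall_congr' fun w => ?_).mpr
    (existsUnique_step hc hτ Z.1 ((1 / Δt ^ 2) • massW ((2 : ℝ) • X.1 - Z.1) -
      (1 / 2 : ℝ) • (gradForm Z.2.1 - fluxW τ Z)))
  have h1 : 𝒯.elemInt (fun T x => (1 / Δt ^ 2) *
        (uval Y.1 T x - 2 * uval X.1 T x + uval Z.1 T x) * uval w T x) =
      1 / Δt ^ 2 * massW Y.1 w - 1 / Δt ^ 2 * massW ((2 : ℝ) • X.1 - Z.1) w := by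
    rw [← mul_sub, ← LinearMap.sub_apply, ← map_sub, ← smul_eq_mul, ← LinearMap.smul_apply,
      ← map_smul, ← elemInt_uval_mul]
    congr 1
    funext T x
    simp only [uval_eq, map_smul, map_sub, pval, MvPolynomial.smul_eval]
    ring
  rw [h1, elemInt_average_grad, skelInt_average_flux]
  simp only [LinearMap.sub_apply, LinearMap.smul_apply, smul_eq_mul]
  constructor <;> intro h <;> linarith

end Triangulation

end HDG

theorem theorem5p3 (Ω : Set HDG.Plane) (hΩ : HDG.IsConvexPolygonalDomain Ω)
    (𝒯 : HDG.Triangulation Ω) (k : ℕ)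
    (τ : 𝒯.Edge → ℝ) (hτ : ∀ e, 0 < τ e)
    (u₁ : HDG.Plane → ℝ) (hu₁ : MeasureTheory.MemLp u₁ 2 (MeasureTheory.volume.restrict Ω))
    (Δt : ℝ) (hΔt_pos : 0 < Δt) (hΔt_le : Δt ≤ 1)
    (n : ℕ) (X : Fin (n + 1) → 𝒯.W k × 𝒯.V k × 𝒯.M k) :
    ∃! Y : 𝒯.W k × 𝒯.V k × 𝒯.M k,
      HDG.Triangulation.IsNextIterate τ Δt u₁ n X Y := by
  -- The data of `MotionEq` reduce to the first triple, or to the last two triples.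
  cases n with
  | zero => exact HDG.Triangulation.existsUnique_firstStep hΩ hτ hu₁ hΔt_pos hΔt_le (X 0)
  | succ n => exact HDG.Triangulation.existsUnique_laterStep hτ hΔt_pos hΔt_le _ _
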